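/- \textbf{Setting.} Let $\mathcal X\subset\mathbb R^d$ be bounded and let $\rho$ be a probability distribution of $z=(x,y)\in\mathcal X\times\{1,-1\}$ with $p:=\Pr(y=1)\in(0,1)$. Put $$f(w)=p(1-p)\,\mathbb E\big[(1-w^\top(x-x'))^2\,\big|\,y=1,\,y'=-1\big],\qquad \phi=f+\Omega,$$ where $(x,y),(x',y')$ are independent with law $\rho$ and $\Omega:\mathbb R^d\to[0,\infty)$ is convex with $\Omega(0)=0$. Let $\Omega'(w)$ denote a (chosen) subgradient of $\Omega$ at $w$. Assume that the set $S^*$ of global minimizers of $\phi$ is nonempty, and for $w\in\mathbb R^d$ let $w^*$ be the Euclidean projection of $w$ onto $S^*$. Assume moreover: (i) (self-bounding) $\|\Omega'(w)\|_2^2\le A_1\Omega(w)+A_2$ for all $w$, with constants $A_1,A_2\ge0$; (ii) (quadratic functional growth) $\phi(w)-\phi(w^*)\ge\sigma_\phi\|w-w^*\|_2^2$ for all $w$, with a constant $\sigma_\phi>0$; (iii) $\sigma_\Omega\ge0$ satisfies $\Omega(w)-\Omega(\tilde w)-\langle w-\tilde w,\Omega'(\tilde w)\rangle\ge\frac{\sigma_\Omega}2\|w-\tilde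 w\|_2^2$ for all $w,\tilde w$, and $\sigma_f:=\sigma_\phi-\sigma_\Omega\ge0$. Let $\kappa=\max\{1,\sup_{x\in\mathcal X}\|x\|_2\}$ and $C_1=\max\{A_1,16\kappa^2\}$. \textbf{Algorithm (SPAUC).} Let $z_i=(x_i,y_i)$, $i=0,1,2,\dots$, be i.i.d. with law $\rho$. For $t\ge1$ let $p_t$ be the fraction of indices $i<t$ with $y_i=1$, and let $u_t$ (resp. $v_t$) be the mean of the $x_i$ with $i<t$ and $y_i=1$ (resp. $y_i=-1$), with value $0$ if there is no such $i$. Let \begin{align*}\hat F_t(w;z)={}&(1-p_t)(w^\top(x-u_t))^2\mathbb I_{[y=1]}+p_t(w^\top(x-v_t))^2\mathbb I_{[y=-1]}+2p_t(1-p_t)w^\top(v_t-u_t)\\&+p_t(1-p_t)(w^\top(v_t-u_t))^2+p_t(1-p_t)\end{align*} and let $\hat F_t'$ be its gradient in $w$. Set $w_1=0$ and, for $t\ge1$, $$w_{t+1}=\arg\min_{w\in\mathbb R^d}\ \eta_t\langle w-w_t,\hat F'_t(w_t;z_t)\rangle+\eta_t\Omega(w)+\tfrac12\|w-w_t\|_2^2,\qquad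 \eta_t=\frac{2}{\sigma_\phi t+2\sigma_f+\sigma_\phi t_1}.$$ \textbf{Theorem.} There are a constant $C$ and an integer $q\ge0$, depending only on $d,\mathcal X,\rho,\Omega,\Omega',A_1,A_2,\sigma_\phi,\sigma_\Omega$ (and not on $T,\delta,t_1,t$), such that for every integer $T>2$, every $\delta\in(0,1)$ and every real $t_1\ge 32\,C_1\sigma_\phi^{-1}\log\frac{2T}{\delta}$, with probability at least $1-\delta$ the following holds simultaneously for all $t=1,\dots,T$: $$\|w_t-w_t^*\|_2^2\le \frac{C\,t_1\log^q(T/\delta)}{t}\qquad\text{and}\qquad \phi\big(\bar w_t^{(2)}\big)-\inf_w\phi(w)\le\frac{C\,t_1^2\log^q(T/\delta)}{t},$$ where $$\bar w_t^{(2)}=\Big(\sum_{k=1}^t(k+t_1+1)\Big)^{-1}\sum_{k=1}^t(k+t_1+1)\,w_k .$$ In particular, if $t_1$ is of the order $\log\frac{2T}{\delta}$, both quantities are $\widetilde O(1/t)$, where $\widetilde O$ hides powers of $\log(T/\delta)$. -/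

import Mathlib

open MeasureTheory ProbabilityTheory Set

namespace SPAUC

noncomputable section

/-- The parameter and input space `ℝ^d` with the Euclidean norm. -/
abbrev Vec (d : ℕ) : Type := EuclideanSpace ℝ (Fin d)

/-- An example `z = (x, y)` with input `x ∈ ℝ^d` and label `y ∈ {1, -1}` (the units of `ℤ`). -/
abbrev Example (d : ℕ) : Type := Vec d × ℤˣ

/-- `p = Pr(y = 1)`. -/
def posProb {d : ℕ} (ρ : Measure (Example d)) : ℝ := ρ.real {z | z.2 = 1}

/-- The AUC risk with the least square loss,
`f(w) = p (1 - p) E[(1 - wᵀ(x - x'))² | y = 1, y' = -1]`, where `(x, y)` and `(x', y')` are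
independent with law `ρ`. -/
def risk {d : ℕ} (ρ : Measure (Example d)) (w : Vec d) : ℝ :=
  posProb ρ * (1 - posProb ρ) *
    ∫ zz : Example d × Example d, (1 - inner ℝ w (zz.1.1 - zz.2.1)) ^ 2
      ∂(ProbabilityTheory.cond (ρ.prod ρ) {zz | zz.1.2 = 1 ∧ zz.2.2 = -1})

/-- The regularized objective `φ = f + Ω`. -/
def objective {d : ℕ} (ρ : Measure (Example d)) (reg : Vec d → ℝ) (w : Vec d) : ℝ :=
  risk ρ w + reg w

/-- The set `S*` of global minimizers of `φ`. -/
def minimizers {d : ℕ} (φ : Vec d → ℝ) : Set (Vec d) := {w | ∀ v, φ w ≤ φ v}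

/-- The projection of `w` onto `S`: a point of `S` at minimal distance from `w` (a junk value if
there is none, which does not happen for nonempty closed `S`, see `nearest_spec`). -/
def nearest {d : ℕ} (S : Set (Vec d)) (w : Vec d) : Vec d :=
  Classical.epsilon fun v => v ∈ S ∧ ∀ u ∈ S, ‖w - v‖ ≤ ‖w - u‖

theorem nearest_spec {d : ℕ} {S : Set (Vec d)} (hS : IsClosed S) (hne : S.Nonempty) (w : Vec d) :
    nearest S w ∈ S ∧ ∀ u ∈ S, ‖w - nearest S w‖ ≤ ‖w - u‖ := by
  refine Classical.epsilon_spec (p := fun v => v ∈ S ∧ ∀ u ∈ S, ‖w - v‖ ≤ ‖w - u‖) ?_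
  obtain ⟨v, hv, h⟩ := hS.exists_infDist_eq_dist hne w
  refine ⟨v, hv, fun u hu => ?_⟩
  rw [← dist_eq_norm, ← dist_eq_norm, ← h]
  exact Metric.infDist_le_dist_of_mem hu

/-- The projection `w*` of `w` onto the set of minimizers of `φ`. -/
def star {d : ℕ} (φ : Vec d → ℝ) (w : Vec d) : Vec d := nearest (minimizers φ) w

/-- `g` is a subgradient of `Ω` at `w`. -/
def IsSubgradientAt {d : ℕ} (reg : Vec d → ℝ) (g w : Vec d) : Prop :=
  ∀ v, reg w + inner ℝ g (v - w) ≤ reg v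

/-- Self-bounding property of the regularizer with chosen subgradients `Ω'` and constants
`A₁, A₂ ≥ 0`: `‖Ω'(w)‖² ≤ A₁ Ω(w) + A₂` for all `w`. -/
def SelfBounding {d : ℕ} (reg : Vec d → ℝ) (reg' : Vec d → Vec d) (A₁ A₂ : ℝ) : Prop :=
  0 ≤ A₁ ∧ 0 ≤ A₂ ∧ ∀ w, ‖reg' w‖ ^ 2 ≤ A₁ * reg w + A₂

/-- Quadratic functional growth: `φ(w) - φ(w*) ≥ σ ‖w - w*‖²` for all `w`. -/
def QuadraticGrowth {d : ℕ} (φ : Vec d → ℝ) (σ : ℝ) : Prop :=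
  0 < σ ∧ ∀ w, σ * ‖w - star φ w‖ ^ 2 ≤ φ w - φ (star φ w)

/-- `κ = max {1, sup_{x ∈ X} ‖x‖}` for the bounded input domain `X`. -/
def kappa {d : ℕ} (X : Set (Vec d)) : ℝ := max 1 (sSup ((fun x => ‖x‖) '' X))

/-- `C₁ = max {A₁, 16 κ²}`. -/
def constC1 {d : ℕ} (X : Set (Vec d)) (A₁ : ℝ) : ℝ := max A₁ (16 * kappa X ^ 2)

/-- The number of indices `i < t` with `y_i = y`. -/
def labelCount {d : ℕ} (z : ℕ → Example d) (y : ℤˣ) (t : ℕ) : ℝ :=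
  ∑ i ∈ Finset.range t, if (z i).2 = y then 1 else 0

/-- The mean of the inputs `x_i`, `i < t`, with `y_i = y` (zero if there are none). -/
def labelMean {d : ℕ} (z : ℕ → Example d) (y : ℤˣ) (t : ℕ) : Vec d :=
  (labelCount z y t)⁻¹ • ∑ i ∈ Finset.range t, if (z i).2 = y then (z i).1 else 0

/-- The empirical estimate `p_t` of `p` from `z_0, …, z_{t-1}`. -/
def empProb {d : ℕ} (z : ℕ → Example d) (t : ℕ) : ℝ := labelCount z 1 t / t

/-- The function `F̂(w; z)` for given values of `p, u, v`. -/
def surrogate {d : ℕ} (p : ℝ) (u v : Vec d) (z : Example d) (w : Vec d) : ℝ :=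
  (if z.2 = 1 then (1 - p) * inner ℝ w (z.1 - u) ^ 2 else 0)
    + (if z.2 = -1 then p * inner ℝ w (z.1 - v) ^ 2 else 0)
    + 2 * p * (1 - p) * inner ℝ w (v - u) + p * (1 - p) * inner ℝ w (v - u) ^ 2 + p * (1 - p)

/-- The gradient of `F̂(·; z)` at `w` for given values of `p, u, v`. -/
def surrogateGrad {d : ℕ} (p : ℝ) (u v : Vec d) (z : Example d) (w : Vec d) : Vec d :=
  (if z.2 = 1 then (2 * (1 - p) * inner ℝ (z.1 - u) w) • (z.1 - u) else 0)
    + (if z.2 = -1 then (2 * p * inner ℝ (z.1 - v) w) • (z.1 - v) else 0)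
    + (2 * p * (1 - p)) • (v - u) + (2 * p * (1 - p) * inner ℝ (v - u) w) • (v - u)

theorem hasGradientAt_surrogate {d : ℕ} (p : ℝ) (u v : Vec d) (z : Example d) (w : Vec d) :
    HasGradientAt (surrogate p u v z) (surrogateGrad p u v z w) w := by
  have h1 : ∀ a : Vec d, HasFDerivAt (fun w : Vec d => inner ℝ w a) (innerSL ℝ a) w := by
    intro a
    have := (innerSL ℝ a).hasFDerivAt (x := w)
    refine this.congr_of_eventuallyEq (Filter.Eventually.of_forall fun x => ?_)
    simp [real_inner_comm]
  have h2 : ∀ (c : ℝ) (a : Vec d), HasFDerivAt (fun w : Vec d => c * inner ℝ w a ^ 2)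
      (InnerProductSpace.toDual ℝ (Vec d) ((2 * c * inner ℝ a w) • a)) w := by
    intro c a
    refine (((h1 a).pow 2).const_mul c).congr_fderiv ?_
    ext x
    simp [real_inner_comm]
    ring
  have h3 : ∀ (c : ℝ) (a : Vec d), HasFDerivAt (fun w : Vec d => c * inner ℝ w a)
      (InnerProductSpace.toDual ℝ (Vec d) (c • a)) w := by
    intro c a
    refine ((h1 a).const_mul c).congr_fderiv ?_
    ext x
    simp
  have h4 : ∀ (P : Prop) [Decidable P] (c : ℝ) (a : Vec d),
      HasFDerivAt (fun w : Vec d => if P then c * inner ℝ w a ^ 2 else 0)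
      (InnerProductSpace.toDual ℝ (Vec d) (if P then (2 * c * inner ℝ a w) • a else 0)) w := by
    intro P _ c a
    by_cases hP : P
    · simpa only [hP, if_true] using h2 c a
    · simpa only [hP, if_false, map_zero] using hasFDerivAt_const (0 : ℝ) w
  rw [hasGradientAt_iff_hasFDerivAt]
  have := ((((h4 (z.2 = 1) (1 - p) (z.1 - u)).add (h4 (z.2 = -1) p (z.1 - v))).add
    (h3 (2 * p * (1 - p)) (v - u))).add (h2 (p * (1 - p)) (v - u))).add_const (p * (1 - p))
  refine this.congr_fderiv ?_
  simp only [surrogateGrad, map_add, mul_assoc]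

/-- The stochastic gradient `F̂'_t(w; z_t)` used at step `t`: the true `p`, `E[x | y = 1]`,
`E[x | y = -1]` are replaced by their empirical counterparts `p_t, u_t, v_t`. -/
def stochGrad {d : ℕ} (z : ℕ → Example d) (t : ℕ) (w : Vec d) : Vec d :=
  surrogateGrad (empProb z t) (labelMean z 1 t) (labelMean z (-1) t) (z t) w

/-- `w_1, w_2, …` is produced by SPAUC from the examples `z_0, z_1, …` with regularizer `Ω` and
step sizes `η_t`: `w_1 = 0` and, for `t ≥ 1`, `w_{t+1}` minimizes
`η_t ⟨v - w_t, F̂'_t(w_t; z_t)⟩ + η_t Ω(v) + ‖v - w_t‖² / 2` over `v ∈ ℝ^d`. -/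
def IsSPAUC {d : ℕ} (reg : Vec d → ℝ) (η : ℕ → ℝ) (z : ℕ → Example d) (w : ℕ → Vec d) : Prop :=
  w 1 = 0 ∧ ∀ t, 1 ≤ t →
    IsMinOn (fun v => η t * inner ℝ (v - w t) (stochGrad z t (w t)) + η t * reg v
      + (1 / 2) * ‖v - w t‖ ^ 2) univ (w (t + 1))

/-- `η_t = 2 / (σ_φ t + 2 σ_f + σ_φ t₁)` with `σ_f = σ_φ - σ_Ω`. -/
def stepSize (σφ σΩ t₁ : ℝ) (t : ℕ) : ℝ := 2 / (σφ * t + 2 * (σφ - σΩ) + σφ * t₁)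

/-- The average of `w_1, …, w_t` with weights proportional to `k + t₁ + 1`. -/
def weightedAverage {d : ℕ} (t₁ : ℝ) (w : ℕ → Vec d) (t : ℕ) : Vec d :=
  (∑ k ∈ Finset.Icc 1 t, ((k : ℝ) + t₁ + 1))⁻¹ •
    ∑ k ∈ Finset.Icc 1 t, ((k : ℝ) + t₁ + 1) • w k

end

end SPAUC

/-! The risk is the mean under ρ of the surrogate built from the true p, E[x | y = 1], E[x | y = -1]
(`risk_eq_integral_surrogate`), a convex quadratic in w. SPAUC is therefore proximal stochastic
gradient descent on φ with two errors: the noise ξ_k of drawing a single example, a martingale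
difference because w_k depends on z_0, …, z_{k-1} only, and the bias caused by using p_k, u_k, v_k.

Write L = log(T/δ), D_k = ‖w_k - w_k*‖², h_k = φ(w_k) - inf φ, a = 2σ_f/σ_φ and s_k = k + t₁ + a, so
that η_k = 2/(σ_φ s_k).

Size of the iterates. The surrogate gradient satisfies ‖∇F‖² ≤ 16κ²F and Ω is self-bounding; since
C₁η_k ≤ 1, comparing each step with the point 0 lets the squared gradients be absorbed by F and Ω.
Hence ‖w_{t+1}‖² is at most a constant times ∑ η_k, which is O(L), as soon as all inputs have norm
at most κ (`IsSPAUC.norm_sq_le`).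

One step. Hoeffding's inequality bounds the error of p_k, u_k, v_k by O(√(L/k)), and comparison with
the projection w_k* yields D_{k+1} ≤ D_k + 2η_k(-h_k + ξ_k + √(D_k M/k)) + η_k² M with M = O(L²)
(`IsSPAUC.norm_sub_star_sq_step`).

Summation. After multiplication by s_k(s_k - 1), quadratic growth σ_φ D_k ≤ h_k makes the distances
telescope and still leaves a positive multiple of ∑ (s_k - 1) h_k on the good side (`weighted_step`,
`recursion_bound`).

Noise. Given the past, ξ_k has squared range O(L) D_k. An exponential supermartingale bounds the
weighted noise by a log-probability term plus a variance term, which by quadratic growth is again a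
small multiple of ∑ (s_k - 1) h_k and is absorbed (`measure_martingale_sum_ge_le`). Dividing by
s_t(s_t - 1) gives the rate of the iterates, Jensen's inequality that of the averages, and a union
bound over t ≤ T the probability. -/

namespace SPAUC

/-! ### Consequences of subgradient inequalities. -/

section Convex

variable {E : Type*} [NormedAddCommGroup E] [InnerProductSpace ℝ E]

/-- Divide by θ and let θ tend to 0. This turns minimality along a segment into a first-order
variational inequality, for projections and for proximal points. -/
theorem nonneg_of_forall_quadratic_nonneg {A B : ℝ}
    (h : ∀ θ : ℝ, 0 < θ → θ ≤ 1 → 0 ≤ θ * A + θ ^ 2 * B) : 0 ≤ A := by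
  by_contra! hA
  have h1 := h 1 one_pos le_rfl
  have hB : 0 < B := by linarith
  have h2 := h (min 1 (-A / (2 * B))) (lt_min one_pos (by apply div_pos <;> linarith))
    (min_le_left _ _)
  set θ := min 1 (-A / (2 * B)) with hθ
  have hθ0 : 0 < θ := lt_min one_pos (by apply div_pos <;> linarith)
  have hθ1 : θ * (2 * B) ≤ -A := by
    rw [← le_div_iff₀ (by linarith)]
    exact min_le_right _ _
  nlinarith

/-- The affine minorant of φ at the barycentre has weighted mean φ(m), since its linear part
averages to zero. -/
theorem jensen_of_subgradient {φ : E → ℝ} {ι : Type*} (s : Finset ι) (a : ι → ℝ) (w : ι → E)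
    (ha : ∀ i ∈ s, 0 ≤ a i) (hs : 0 < ∑ i ∈ s, a i)
    (hφ : ∀ w, ∃ g, ∀ v, φ w + inner ℝ g (v - w) ≤ φ v) :
    (∑ i ∈ s, a i) * φ ((∑ i ∈ s, a i)⁻¹ • ∑ i ∈ s, a i • w i) ≤ ∑ i ∈ s, a i * φ (w i) := by
  set m := (∑ i ∈ s, a i)⁻¹ • ∑ i ∈ s, a i • w i with hm
  obtain ⟨g, hg⟩ := hφ m
  have h1 : ∑ i ∈ s, a i * (φ m + inner ℝ g (w i - m)) ≤ ∑ i ∈ s, a i * φ (w i) :=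
    Finset.sum_le_sum fun i hi => mul_le_mul_of_nonneg_left (hg _) (ha i hi)
  have h2 : ∑ i ∈ s, a i * inner ℝ g (w i - m) = 0 := by
    have : ∑ i ∈ s, a i * inner ℝ g (w i - m) = inner ℝ g (∑ i ∈ s, a i • (w i - m)) := by
      rw [inner_sum]
      exact Finset.sum_congr rfl fun i _ => by rw [inner_smul_right]
    rw [this]
    simp_rw [smul_sub]
    rw [Finset.sum_sub_distrib, ← Finset.sum_smul, hm, smul_inv_smul₀ hs.ne', sub_self,
      inner_zero_right]
  simp_rw [mul_add] at h1
  rw [Finset.sum_add_distrib, h2, ← Finset.sum_mul] at h1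
  linarith

theorem convexOn_of_subgradient {φ : E → ℝ}
    (hφ : ∀ w, ∃ g, ∀ v, φ w + inner ℝ g (v - w) ≤ φ v) : ConvexOn ℝ univ φ := by
  refine ⟨convex_univ, fun x _ y _ a b ha hb hab => ?_⟩
  obtain ⟨g, hg⟩ := hφ (a • x + b • y)
  have h1 := mul_le_mul_of_nonneg_left (hg x) ha
  have h2 := mul_le_mul_of_nonneg_left (hg y) hb
  have h3 : a * inner ℝ g (x - (a • x + b • y)) + b * inner ℝ g (y - (a • x + b • y)) = 0 := by
    obtain rfl : b = 1 - a := by linarith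
    simp only [inner_sub_right, inner_add_right, inner_smul_right]
    ring
  obtain rfl : b = 1 - a := by linarith
  simp only [smul_eq_mul]
  linarith

theorem norm_sub_le_of_inner_le {y y' v v' : E} (h : inner ℝ (y - v) (v' - v) ≤ inner ℝ (y' - v') (v' - v)) :
    ‖v - v'‖ ≤ ‖y - y'‖ := by
  have h1 : ‖v' - v‖ ^ 2 ≤ inner ℝ (y' - y) (v' - v) := by
    rw [← real_inner_self_eq_norm_sq]
    have : inner ℝ (y' - y) (v' - v) - inner ℝ (v' - v) (v' - v)
        = inner ℝ (y' - v') (v' - v) - inner ℝ (y - v) (v' - v) := by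
      simp only [← inner_sub_left]
      congr 1
      abel
    linarith
  have h2 := real_inner_le_norm (y' - y) (v' - v)
  rw [norm_sub_rev v v', norm_sub_rev y y']
  by_contra! hlt
  nlinarith [norm_nonneg (y' - y)]

end Convex

/-! ### Projection onto the set of minimizers. -/

section Projection

variable {d : ℕ}

theorem inner_sub_nearest_le {S : Set (Vec d)} (hS : IsClosed S) (hc : Convex ℝ S)
    (hne : S.Nonempty) (w : Vec d) {u : Vec d} (hu : u ∈ S) :
    inner ℝ (w - nearest S w) (u - nearest S w) ≤ 0 := by
  obtain ⟨hv, hmin⟩ := nearest_spec hS hne w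
  set v := nearest S w
  suffices h : 0 ≤ -(2 * inner ℝ (w - v) (u - v)) by linarith
  refine nonneg_of_forall_quadratic_nonneg (B := ‖u - v‖ ^ 2) fun θ h0 h1 => ?_
  have hmem : v + θ • (u - v) ∈ S := hc.add_smul_sub_mem hv hu ⟨h0.le, h1⟩
  have h2 := pow_le_pow_left₀ (norm_nonneg _) (hmin _ hmem) 2
  rw [show w - (v + θ • (u - v)) = (w - v) - θ • (u - v) by abel,
    norm_sub_sq_real (w - v), inner_smul_right, norm_smul, mul_pow, Real.norm_eq_abs, sq_abs] at h2
  linarith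

/-- The variational inequalities at the two projections add up to nonexpansiveness. Continuity is
needed only to make the noise a measurable function of the examples. -/
theorem continuous_nearest {S : Set (Vec d)} (hS : IsClosed S) (hc : Convex ℝ S)
    (hne : S.Nonempty) : Continuous (nearest S) := by
  have : LipschitzWith 1 (nearest S) := by
    refine LipschitzWith.of_dist_le_mul fun w w' => ?_
    rw [dist_eq_norm, dist_eq_norm, NNReal.coe_one, one_mul]
    refine norm_sub_le_of_inner_le ?_
    have h1 := inner_sub_nearest_le hS hc hne w (nearest_spec hS hne w').1
    have h2 := inner_sub_nearest_le hS hc hne w' (nearest_spec hS hne w).1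
    rw [← neg_sub (nearest S w') (nearest S w), inner_neg_right] at h2
    linarith
  exact this.continuous

theorem minimizers_eq_sublevel {φ : Vec d → ℝ} {m : Vec d} (hm : m ∈ minimizers φ) :
    minimizers φ = {w | φ w ≤ φ m} :=
  Set.ext fun _ => ⟨fun h => h m, fun h v => le_trans h (hm v)⟩

theorem isClosed_minimizers {φ : Vec d → ℝ} (hφ : ConvexOn ℝ univ φ)
    (hne : (minimizers φ).Nonempty) : IsClosed (minimizers φ) := by
  obtain ⟨m, hm⟩ := hne
  rw [minimizers_eq_sublevel hm]
  exact isClosed_le hφ.locallyLipschitz.continuous continuous_const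

theorem convex_minimizers {φ : Vec d → ℝ} (hφ : ConvexOn ℝ univ φ)
    (hne : (minimizers φ).Nonempty) : Convex ℝ (minimizers φ) := by
  obtain ⟨m, hm⟩ := hne
  rw [minimizers_eq_sublevel hm]
  simpa using hφ.convex_le (φ m)

theorem star_mem {φ : Vec d → ℝ} (hφ : ConvexOn ℝ univ φ) (hne : (minimizers φ).Nonempty)
    (w : Vec d) : star φ w ∈ minimizers φ :=
  (nearest_spec (isClosed_minimizers hφ hne) hne w).1

theorem norm_sub_star_le {φ : Vec d → ℝ} (hφ : ConvexOn ℝ univ φ)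
    (hne : (minimizers φ).Nonempty) (w : Vec d) {u : Vec d} (hu : u ∈ minimizers φ) :
    ‖w - star φ w‖ ≤ ‖w - u‖ :=
  (nearest_spec (isClosed_minimizers hφ hne) hne w).2 u hu

theorem continuous_star {φ : Vec d → ℝ} (hφ : ConvexOn ℝ univ φ)
    (hne : (minimizers φ).Nonempty) : Continuous (star φ) :=
  continuous_nearest (isClosed_minimizers hφ hne) (convex_minimizers hφ hne) hne

theorem iInf_eq_apply_star {φ : Vec d → ℝ} (hφ : ConvexOn ℝ univ φ)
    (hne : (minimizers φ).Nonempty) (w : Vec d) : ⨅ v, φ v = φ (star φ w) := by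
  have h := star_mem hφ hne w
  exact le_antisymm (ciInf_le ⟨φ (star φ w), by rintro _ ⟨v, rfl⟩; exact h v⟩ _) (le_ciInf h)

end Projection

/-! ### The proximal step. -/

section Prox

variable {d : ℕ}

/-- `v` is the proximal point of `ψ` at `y`, in variational form. -/
def IsProx (ψ : Vec d → ℝ) (y v : Vec d) : Prop :=
  ∀ u, ψ v + inner ℝ (y - v) (u - v) ≤ ψ u

theorem isProx_of_forall_le {ψ : Vec d → ℝ} (hψ : ConvexOn ℝ univ ψ) {y v : Vec d}
    (h : ∀ u, ψ v + (1 / 2) * ‖v - y‖ ^ 2 ≤ ψ u + (1 / 2) * ‖u - y‖ ^ 2) : IsProx ψ y v := by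
  intro u
  suffices h' : 0 ≤ ψ u - ψ v - inner ℝ (y - v) (u - v) by linarith
  refine nonneg_of_forall_quadratic_nonneg (B := (1 / 2) * ‖u - v‖ ^ 2) fun θ h0 h1 => ?_
  have h2 := h (v + θ • (u - v))
  have h3 := hψ.2 (mem_univ v) (mem_univ u) (sub_nonneg.2 h1) h0.le (by ring)
  rw [show (1 - θ) • v + θ • u = v + θ • (u - v) by module] at h3
  simp only [smul_eq_mul] at h3
  rw [show v + θ • (u - v) - y = (v - y) + θ • (u - v) by abel, norm_add_sq_real,
    inner_smul_right, norm_smul, mul_pow, Real.norm_eq_abs, sq_abs, ← neg_sub y v,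
    inner_neg_left] at h2
  linarith

/-- Testing each variational inequality at the other point cancels the values of ψ. The bound gives
both uniqueness of the proximal point and continuity of the proximal map. -/
theorem IsProx.norm_sub_le {ψ : Vec d → ℝ} {y y' v v' : Vec d} (h : IsProx ψ y v)
    (h' : IsProx ψ y' v') : ‖v - v'‖ ≤ ‖y - y'‖ := by
  refine norm_sub_le_of_inner_le ?_
  have h1 := h v'
  have h2 := h' v
  rw [← neg_sub v' v, inner_neg_right] at h2
  linarith

theorem exists_isProx {ψ : Vec d → ℝ} (hψ : ConvexOn ℝ univ ψ) (h0 : ∀ v, 0 ≤ ψ v) (y : Vec d) :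
    ∃ v, IsProx ψ y v := by
  have hc : Continuous fun v => ψ v + (1 / 2) * ‖v - y‖ ^ 2 := by
    have := hψ.locallyLipschitz.continuous
    fun_prop
  have ht : Filter.Tendsto (fun v => ψ v + (1 / 2) * ‖v - y‖ ^ 2) (Filter.cocompact (Vec d))
      Filter.atTop := by
    have h1 : Filter.Tendsto (fun v : Vec d => ‖v - y‖) (Filter.cocompact (Vec d))
        Filter.atTop := by
      simpa only [dist_eq_norm] using tendsto_dist_right_cocompact_atTop y
    have h2 : Filter.Tendsto (fun v : Vec d => (1 / 2) * ‖v - y‖ ^ 2) (Filter.cocompact (Vec d))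
        Filter.atTop :=
      ((Filter.tendsto_pow_atTop two_ne_zero).comp h1).const_mul_atTop (by norm_num)
    exact Filter.tendsto_atTop_mono (fun v => by linarith [h0 v]) h2
  obtain ⟨v, hv⟩ := hc.exists_forall_le ht
  exact ⟨v, isProx_of_forall_le hψ hv⟩

/-- The proximal map of `ψ`. -/
noncomputable def prox (ψ : Vec d → ℝ) (y : Vec d) : Vec d := Classical.epsilon fun v => IsProx ψ y v

theorem isProx_prox {ψ : Vec d → ℝ} (hψ : ConvexOn ℝ univ ψ) (h0 : ∀ v, 0 ≤ ψ v) (y : Vec d) :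
    IsProx ψ y (prox ψ y) :=
  Classical.epsilon_spec (exists_isProx hψ h0 y)

theorem IsProx.eq_prox {ψ : Vec d → ℝ} (hψ : ConvexOn ℝ univ ψ) (h0 : ∀ v, 0 ≤ ψ v)
    {y v : Vec d} (h : IsProx ψ y v) : v = prox ψ y := by
  have := h.norm_sub_le (isProx_prox hψ h0 y)
  rwa [sub_self, norm_zero, norm_le_zero_iff, sub_eq_zero] at this

theorem continuous_prox {ψ : Vec d → ℝ} (hψ : ConvexOn ℝ univ ψ) (h0 : ∀ v, 0 ≤ ψ v) :
    Continuous (prox ψ) := by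
  have : LipschitzWith 1 (prox ψ) := by
    refine LipschitzWith.of_dist_le_mul fun w w' => ?_
    rw [dist_eq_norm, dist_eq_norm, NNReal.coe_one, one_mul]
    exact (isProx_prox hψ h0 w).norm_sub_le (isProx_prox hψ h0 w')
  exact this.continuous

theorem IsSPAUC.isProx {reg : Vec d → ℝ} (hreg : ConvexOn ℝ univ reg) {η : ℕ → ℝ}
    (hη : ∀ t, 0 ≤ η t) {z : ℕ → Example d} {w : ℕ → Vec d} (h : IsSPAUC reg η z w) {t : ℕ}
    (ht : 1 ≤ t) :
    IsProx (fun v => η t * reg v) (w t - η t • stochGrad z t (w t)) (w (t + 1)) := by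
  have hc : ConvexOn ℝ univ fun v => η t * reg v := by simpa using hreg.smul (hη t)
  refine isProx_of_forall_le hc fun u => ?_
  have h1 := h.2 t ht (mem_univ u)
  simp only [mem_ofPred_eq] at h1
  set g := stochGrad z t (w t)
  have key : ∀ v, (1 / 2) * ‖v - (w t - η t • g)‖ ^ 2
      = η t * inner ℝ (v - w t) g + (1 / 2) * ‖v - w t‖ ^ 2 + (1 / 2) * ‖η t • g‖ ^ 2 := by
    intro v
    rw [show v - (w t - η t • g) = (v - w t) + η t • g by abel, norm_add_sq_real,
      inner_smul_right]
    ring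
  simp only [key]
  linarith

/-- One step of a proximal stochastic gradient method: `g'` is a subgradient of the regularizer
at `w`, `g` the stochastic gradient. -/
theorem IsProx.norm_sub_sq_le {reg : Vec d → ℝ} {η : ℝ} (hη : 0 ≤ η) {w w' g g' : Vec d}
    (h : IsProx (fun v => η * reg v) (w - η • g) w') (hg' : IsSubgradientAt reg g' w) (v : Vec d) :
    ‖w' - v‖ ^ 2 ≤ ‖w - v‖ ^ 2 + 2 * η * inner ℝ g (v - w) + 2 * η * (reg v - reg w)
      + η ^ 2 * ‖g + g'‖ ^ 2 := by
  have h1 := h v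
  have h2 := mul_le_mul_of_nonneg_left (hg' w') hη
  -- The subgradient is taken at the old point w, so terms linear in w' - w remain. Completing the
  -- square pays for them with ‖w' - w‖², at the cost of η²‖g + g'‖².
  have h3 : (0 : ℝ) ≤ ‖(w' - w) + η • (g + g')‖ ^ 2 := by positivity
  have e1 : ‖w - v‖ ^ 2 = ‖w' - w‖ ^ 2 + 2 * inner ℝ (w' - w) (v - w') + ‖w' - v‖ ^ 2 := by
    have : w - v = -((w' - w) + (v - w')) := by abel
    rw [this, norm_neg, norm_add_sq_real, norm_sub_rev v w']
  rw [norm_add_sq_real, inner_smul_right, norm_smul, mul_pow, Real.norm_eq_abs, sq_abs] at h3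
  have e2 : inner ℝ (w - η • g - w') (v - w')
      = -inner ℝ (w' - w) (v - w') - η * (inner ℝ g (v - w) - inner ℝ g (w' - w)) := by
    have : w - η • g - w' = -(w' - w) - η • g := by abel
    rw [this, inner_sub_left, inner_neg_left, inner_smul_left, ← inner_sub_right]
    simp
  rw [e2] at h1
  rw [inner_add_right, real_inner_comm g, real_inner_comm g'] at h3
  linarith

end Prox

/-! ### The surrogate: convexity, self-bounding, and stability in p, u, v. -/

section Surrogate

variable {d : ℕ}

/-- Completing the square in the terms free of z gives p(1 - p)(1 + ⟨v - u, w⟩)², so for either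
label the surrogate is a nonnegative combination of two squares when 0 ≤ p ≤ 1. -/
theorem surrogate_pos_neg (p : ℝ) (u v : Vec d) (z : Example d) :
    ∃ (c : ℝ) (a : Vec d), (z.2 = 1 ∧ c = 1 - p ∧ a = z.1 - u ∨ z.2 = -1 ∧ c = p ∧ a = z.1 - v) ∧
      (∀ w, surrogate p u v z w
        = c * inner ℝ a w ^ 2 + p * (1 - p) * (1 + inner ℝ (v - u) w) ^ 2) ∧
      ∀ w, surrogateGrad p u v z w = (2 * c * inner ℝ a w) • a
        + (2 * (p * (1 - p)) * (1 + inner ℝ (v - u) w)) • (v - u) := by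
  rcases Int.units_eq_one_or z.2 with h | h
  · refine ⟨1 - p, z.1 - u, Or.inl ⟨h, rfl, rfl⟩, fun w => ?_, fun w => ?_⟩
    · simp only [surrogate, h, if_true, show ¬((1 : ℤˣ) = -1) by decide, if_false,
        real_inner_comm w]
      ring
    · simp only [surrogateGrad, h, if_true, show ¬((1 : ℤˣ) = -1) by decide, if_false]
      module
  · refine ⟨p, z.1 - v, Or.inr ⟨h, rfl, rfl⟩, fun w => ?_, fun w => ?_⟩
    · simp only [surrogate, h, if_true, show ¬((-1 : ℤˣ) = 1) by decide, if_false,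
        real_inner_comm w]
      ring
    · simp only [surrogateGrad, h, if_true, show ¬((-1 : ℤˣ) = 1) by decide, if_false]
      module

theorem surrogate_add_inner_le {p : ℝ} (h0 : 0 ≤ p) (h1 : p ≤ 1) (u v : Vec d) (z : Example d)
    (w w' : Vec d) : surrogate p u v z w + inner ℝ (surrogateGrad p u v z w) (w' - w)
      ≤ surrogate p u v z w' := by
  obtain ⟨c, a, hc, hF, hG⟩ := surrogate_pos_neg p u v z
  have hc0 : 0 ≤ c := by rcases hc with ⟨-, rfl, -⟩ | ⟨-, rfl, -⟩ <;> linarith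
  have hq : 0 ≤ p * (1 - p) := mul_nonneg h0 (by linarith)
  rw [hF, hF, hG, inner_add_left, real_inner_smul_left, real_inner_smul_left, inner_sub_right,
    inner_sub_right]
  nlinarith [mul_nonneg hc0 (sq_nonneg (inner ℝ a w' - inner ℝ a w)),
    mul_nonneg hq (sq_nonneg (inner ℝ (v - u) w' - inner ℝ (v - u) w))]

theorem surrogate_nonneg {p : ℝ} (h0 : 0 ≤ p) (h1 : p ≤ 1) (u v : Vec d) (z : Example d)
    (w : Vec d) : 0 ≤ surrogate p u v z w := by
  obtain ⟨c, a, hc, hF, hG⟩ := surrogate_pos_neg p u v z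
  have hc0 : 0 ≤ c := by rcases hc with ⟨-, rfl, -⟩ | ⟨-, rfl, -⟩ <;> linarith
  have hq : 0 ≤ p * (1 - p) := mul_nonneg h0 (by linarith)
  rw [hF]
  positivity

theorem norm_sub_le_two_mul {E : Type*} [SeminormedAddCommGroup E] {x y : E} {κ : ℝ}
    (hx : ‖x‖ ≤ κ) (hy : ‖y‖ ≤ κ) : ‖x - y‖ ≤ 2 * κ := by
  linarith [norm_sub_le x y]

/-- The two squares carry weights c and q = p(1 - p) with c + q ≤ 1, and both directions have norm
at most 2κ. Cauchy–Schwarz gives (c|A| + q|B|)² ≤ (c + q)(cA² + qB²), and the last factor is the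
surrogate itself. -/
theorem norm_surrogateGrad_sq_le {p κ : ℝ} (h0 : 0 ≤ p) (h1 : p ≤ 1) {u v : Vec d}
    {z : Example d} (hu : ‖u‖ ≤ κ) (hv : ‖v‖ ≤ κ) (hz : ‖z.1‖ ≤ κ) (w : Vec d) :
    ‖surrogateGrad p u v z w‖ ^ 2 ≤ 16 * κ ^ 2 * surrogate p u v z w := by
  obtain ⟨c, a, hc, hF, hG⟩ := surrogate_pos_neg p u v z
  have hκ : 0 ≤ κ := (norm_nonneg _).trans hu
  have hc0 : 0 ≤ c := by rcases hc with ⟨-, rfl, -⟩ | ⟨-, rfl, -⟩ <;> linarith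
  have ha : ‖a‖ ≤ 2 * κ := by
    rcases hc with ⟨-, -, rfl⟩ | ⟨-, -, rfl⟩ <;> exact norm_sub_le_two_mul hz ‹_›
  have hq : 0 ≤ p * (1 - p) := mul_nonneg h0 (by linarith)
  have hcq : c + p * (1 - p) ≤ 1 := by
    rcases hc with ⟨-, rfl, -⟩ | ⟨-, rfl, -⟩ <;> nlinarith
  rw [hF, hG]
  generalize p * (1 - p) = q at *
  set A := inner ℝ a w
  set B := 1 + inner ℝ (v - u) w
  have h2 : ‖(2 * c * A) • a + (2 * q * B) • (v - u)‖ ≤ 4 * κ * (c * |A| + q * |B|) := by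
    refine (norm_add_le _ _).trans ?_
    rw [norm_smul, norm_smul, Real.norm_eq_abs, Real.norm_eq_abs, abs_mul, abs_mul (2 * q),
      abs_of_nonneg (show 0 ≤ 2 * c by linarith), abs_of_nonneg (show 0 ≤ 2 * q by linarith)]
    have := mul_le_mul_of_nonneg_left ha (show 0 ≤ 2 * c * |A| by positivity)
    have := mul_le_mul_of_nonneg_left (norm_sub_le_two_mul hv hu)
      (show 0 ≤ 2 * q * |B| by positivity)
    linarith
  have h3 : (c * |A| + q * |B|) ^ 2 ≤ c * A ^ 2 + q * B ^ 2 := by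
    have h4 : (c * |A| + q * |B|) ^ 2 ≤ (c + q) * (c * A ^ 2 + q * B ^ 2) := by
      rw [← sq_abs A, ← sq_abs B]
      nlinarith [mul_nonneg (mul_nonneg hc0 hq) (sq_nonneg (|A| - |B|))]
    have : 0 ≤ c * A ^ 2 + q * B ^ 2 := by positivity
    nlinarith
  calc _ ≤ (4 * κ * (c * |A| + q * |B|)) ^ 2 := pow_le_pow_left₀ (norm_nonneg _) h2 2
    _ = 16 * κ ^ 2 * (c * |A| + q * |B|) ^ 2 := by ring
    _ ≤ _ := by gcongr

theorem surrogate_le {p κ : ℝ} (h0 : 0 ≤ p) (h1 : p ≤ 1) {u v : Vec d}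
    {z : Example d} (hu : ‖u‖ ≤ κ) (hv : ‖v‖ ≤ κ) (hz : ‖z.1‖ ≤ κ) (hκ : 1 ≤ κ) (w : Vec d) :
    surrogate p u v z w ≤ 4 * κ ^ 2 * (1 + ‖w‖) ^ 2 := by
  obtain ⟨c, a, hc, hF, hG⟩ := surrogate_pos_neg p u v z
  have hc0 : 0 ≤ c := by rcases hc with ⟨-, rfl, -⟩ | ⟨-, rfl, -⟩ <;> linarith
  have ha : ‖a‖ ≤ 2 * κ := by
    rcases hc with ⟨-, -, rfl⟩ | ⟨-, -, rfl⟩ <;> exact norm_sub_le_two_mul hz ‹_›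
  have hq : 0 ≤ p * (1 - p) := mul_nonneg h0 (by linarith)
  have hcq : c + p * (1 - p) ≤ 1 := by
    rcases hc with ⟨-, rfl, -⟩ | ⟨-, rfl, -⟩ <;> nlinarith
  have hw := norm_nonneg w
  have hb : ∀ b : Vec d, ‖b‖ ≤ 2 * κ → |inner ℝ b w| ≤ 2 * κ * ‖w‖ := fun b hb =>
    (abs_real_inner_le_norm b w).trans (by gcongr)
  have hA : inner ℝ a w ^ 2 ≤ 4 * κ ^ 2 * (1 + ‖w‖) ^ 2 := by
    rw [← sq_abs]
    calc _ ≤ (2 * κ * (1 + ‖w‖)) ^ 2 :=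
          pow_le_pow_left₀ (abs_nonneg _) ((hb a ha).trans (by gcongr; linarith)) 2
      _ = _ := by ring
  have hB : (1 + inner ℝ (v - u) w) ^ 2 ≤ 4 * κ ^ 2 * (1 + ‖w‖) ^ 2 := by
    rw [← sq_abs]
    have h2 : |1 + inner ℝ (v - u) w| ≤ 2 * κ * (1 + ‖w‖) := by
      refine (abs_add_le _ _).trans ?_
      rw [abs_one]
      linarith [hb _ (norm_sub_le_two_mul hv hu)]
    calc _ ≤ (2 * κ * (1 + ‖w‖)) ^ 2 := pow_le_pow_left₀ (abs_nonneg _) h2 2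
      _ = _ := by ring
  rw [hF]
  generalize p * (1 - p) = q at *
  have : 0 ≤ 4 * κ ^ 2 * (1 + ‖w‖) ^ 2 := by positivity
  nlinarith [mul_le_mul_of_nonneg_left hA hc0, mul_le_mul_of_nonneg_left hB hq]

theorem norm_surrogateGrad_le {p κ : ℝ} (h0 : 0 ≤ p) (h1 : p ≤ 1) {u v : Vec d}
    {z : Example d} (hu : ‖u‖ ≤ κ) (hv : ‖v‖ ≤ κ) (hz : ‖z.1‖ ≤ κ) (hκ : 1 ≤ κ) (w : Vec d) :
    ‖surrogateGrad p u v z w‖ ≤ 8 * κ ^ 2 * (1 + ‖w‖) := by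
  refine le_of_sq_le_sq ?_ (by positivity)
  have h2 := norm_surrogateGrad_sq_le h0 h1 hu hv hz w
  have h3 := surrogate_le h0 h1 hu hv hz hκ w
  calc _ ≤ 16 * κ ^ 2 * surrogate p u v z w := h2
    _ ≤ 16 * κ ^ 2 * (4 * κ ^ 2 * (1 + ‖w‖) ^ 2) := by gcongr
    _ = _ := by ring

theorem surrogate_zero (p : ℝ) (u v : Vec d) (z : Example d) :
    surrogate p u v z 0 = p * (1 - p) := by
  simp [surrogate]

theorem norm_rankOne_sub_le {E : Type*} [NormedAddCommGroup E] [InnerProductSpace ℝ E]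
    {α β M : ℝ} {a b w : E} (hβ : |β| ≤ 2) (ha : ‖a‖ ≤ M) (hb : ‖b‖ ≤ M) :
    ‖(α * inner ℝ a w) • a - (β * inner ℝ b w) • b‖
      ≤ |α - β| * M ^ 2 * ‖w‖ + 4 * M * ‖w‖ * ‖a - b‖ := by
  have hM : 0 ≤ M := (norm_nonneg _).trans ha
  have e : (α * inner ℝ a w) • a - (β * inner ℝ b w) • b
      = ((α - β) * inner ℝ a w) • a + ((β * inner ℝ a w) • (a - b)
        + (β * inner ℝ (a - b) w) • b) := by
    rw [inner_sub_left]
    module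
  rw [e]
  refine (norm_add_le _ _).trans (add_le_add ?_ ((norm_add_le _ _).trans ?_))
  · rw [norm_smul, Real.norm_eq_abs, abs_mul]
    calc |α - β| * |inner ℝ a w| * ‖a‖ ≤ |α - β| * (M * ‖w‖) * M := by
          gcongr
          exact (abs_real_inner_le_norm a w).trans (by gcongr)
      _ = _ := by ring
  · rw [norm_smul, norm_smul, Real.norm_eq_abs, Real.norm_eq_abs, abs_mul, abs_mul]
    have h1 : |β| * |inner ℝ a w| * ‖a - b‖ ≤ 2 * (M * ‖w‖) * ‖a - b‖ := by
      gcongr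
      exact (abs_real_inner_le_norm a w).trans (by gcongr)
    have h2 : |β| * |inner ℝ (a - b) w| * ‖b‖ ≤ 2 * (‖a - b‖ * ‖w‖) * M := by
      gcongr
      exact abs_real_inner_le_norm (a - b) w
    linarith

/-- The gradient is a sum of rank-one terms α⟨a, w⟩a and a multiple of v - u, whose coefficients and
directions are Lipschitz in (p, u, v) on the bounded range. The example z is the same on both sides,
so only equal labels are compared. -/
theorem norm_surrogateGrad_sub_le {p p' κ : ℝ} (h0 : 0 ≤ p) (h1 : p ≤ 1) (h0' : 0 ≤ p')
    (h1' : p' ≤ 1) {u v u' v' : Vec d} {z : Example d} (hu : ‖u‖ ≤ κ) (hv : ‖v‖ ≤ κ)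
    (hu' : ‖u'‖ ≤ κ) (hv' : ‖v'‖ ≤ κ) (hz : ‖z.1‖ ≤ κ) (hκ : 1 ≤ κ) (w : Vec d) :
    ‖surrogateGrad p u v z w - surrogateGrad p' u' v' z w‖
      ≤ 28 * κ ^ 2 * (1 + ‖w‖) * (|p - p'| + ‖u - u'‖ + ‖v - v'‖) := by
  have hκ0 : 0 ≤ κ := by linarith
  have hw := norm_nonneg w
  have huu := norm_nonneg (u - u')
  have hvv := norm_nonneg (v - v')
  have hpp := abs_nonneg (p - p')
  have hκκ : κ ≤ κ ^ 2 := by nlinarith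
  have hκ2 : 0 ≤ κ ^ 2 := by positivity
  obtain ⟨c, a, hc, -, hG⟩ := surrogate_pos_neg p u v z
  obtain ⟨c', a', hc', -, hG'⟩ := surrogate_pos_neg p' u' v' z
  have hne : (1 : ℤˣ) ≠ -1 := by decide
  have hcc : |2 * c - 2 * c'| = 2 * |p - p'| := by
    rcases hc with ⟨e, rfl, -⟩ | ⟨e, rfl, -⟩ <;> rcases hc' with ⟨e', rfl, -⟩ | ⟨e', rfl, -⟩
    · rw [show 2 * (1 - p) - 2 * (1 - p') = -(2 * (p - p')) by ring, abs_neg, abs_mul, abs_two]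
    · exact absurd (e.symm.trans e') hne
    · exact absurd (e'.symm.trans e) hne
    · rw [← mul_sub, abs_mul, abs_two]
  have haa : ‖a - a'‖ ≤ ‖u - u'‖ + ‖v - v'‖ := by
    rcases hc with ⟨e, -, rfl⟩ | ⟨e, -, rfl⟩ <;> rcases hc' with ⟨e', -, rfl⟩ | ⟨e', -, rfl⟩
    · rw [sub_sub_sub_cancel_left, norm_sub_rev]; linarith
    · exact absurd (e.symm.trans e') hne
    · exact absurd (e'.symm.trans e) hne
    · rw [sub_sub_sub_cancel_left, norm_sub_rev]; linarith
  have ha : ‖a‖ ≤ 2 * κ := by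
    rcases hc with ⟨-, -, rfl⟩ | ⟨-, -, rfl⟩ <;> exact norm_sub_le_two_mul hz ‹_›
  have ha' : ‖a'‖ ≤ 2 * κ := by
    rcases hc' with ⟨-, -, rfl⟩ | ⟨-, -, rfl⟩ <;> exact norm_sub_le_two_mul hz ‹_›
  have hcb : |2 * c'| ≤ 2 := by
    rw [abs_le]
    rcases hc' with ⟨-, rfl, -⟩ | ⟨-, rfl, -⟩ <;> constructor <;> linarith
  have hq' : |2 * (p' * (1 - p'))| ≤ 1 := by
    rw [abs_le]; constructor <;> nlinarith [sq_nonneg (p' - 1 / 2)]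
  have hqq : |2 * (p * (1 - p)) - 2 * (p' * (1 - p'))| ≤ 2 * |p - p'| := by
    rw [show 2 * (p * (1 - p)) - 2 * (p' * (1 - p')) = 2 * ((p - p') * (1 - p - p')) by ring,
      abs_mul, abs_two, abs_mul]
    have : |1 - p - p'| ≤ 1 := by rw [abs_le]; constructor <;> linarith
    nlinarith
  have hbb : ‖(v - u) - (v' - u')‖ ≤ ‖u - u'‖ + ‖v - v'‖ := by
    rw [sub_sub_sub_comm, add_comm]
    exact norm_sub_le _ _
  have hb := norm_sub_le_two_mul hv hu
  have hb' := norm_sub_le_two_mul hv' hu'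
  have k1 := norm_rankOne_sub_le (α := 2 * c) (w := w) hcb ha ha'
  have k2 := norm_rankOne_sub_le (α := 2 * (p * (1 - p))) (w := w) (hq'.trans one_le_two) hb hb'
  generalize 2 * (p * (1 - p)) = q at *
  generalize 2 * (p' * (1 - p')) = q' at *
  have k3 : ‖q • (v - u) - q' • (v' - u')‖
      ≤ 2 * |p - p'| * (2 * κ) + 1 * (‖u - u'‖ + ‖v - v'‖) := by
    rw [show q • (v - u) - q' • (v' - u') = (q - q') • (v - u) + q' • ((v - u) - (v' - u')) by
      module]
    refine (norm_add_le _ _).trans ?_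
    rw [norm_smul, norm_smul, Real.norm_eq_abs, Real.norm_eq_abs]
    gcongr
  rw [hG, hG', show (2 * c * inner ℝ a w) • a + (q * (1 + inner ℝ (v - u) w)) • (v - u)
      - ((2 * c' * inner ℝ a' w) • a' + (q' * (1 + inner ℝ (v' - u') w)) • (v' - u'))
      = ((2 * c * inner ℝ a w) • a - (2 * c' * inner ℝ a' w) • a')
        + (((q * inner ℝ (v - u) w) • (v - u) - (q' * inner ℝ (v' - u') w) • (v' - u'))
        + (q • (v - u) - q' • (v' - u'))) by module]
  refine (norm_add_le _ _).trans ((add_le_add k1 ((norm_add_le _ _).trans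
    (add_le_add k2 k3))).trans ?_)
  rw [hcc]
  set e := ‖u - u'‖ + ‖v - v'‖ with he
  have he0 : 0 ≤ e := by positivity
  calc _ ≤ 2 * |p - p'| * (2 * κ) ^ 2 * ‖w‖ + 4 * (2 * κ) * ‖w‖ * e
        + (2 * |p - p'| * (2 * κ) ^ 2 * ‖w‖ + 4 * (2 * κ) * ‖w‖ * e
          + (2 * |p - p'| * (2 * κ) + 1 * e)) := by gcongr
    _ = 16 * κ ^ 2 * ‖w‖ * |p - p'| + 16 * κ * ‖w‖ * e + 4 * κ * |p - p'| + 1 * e := by ring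
    _ ≤ 16 * κ ^ 2 * ‖w‖ * |p - p'| + 16 * κ ^ 2 * ‖w‖ * e + 4 * κ ^ 2 * |p - p'|
        + κ ^ 2 * e := by
      gcongr
      linarith
    _ ≤ _ := by
      have h3 : 0 ≤ κ ^ 2 * ‖w‖ * |p - p'| := by positivity
      have h4 : 0 ≤ κ ^ 2 * ‖w‖ * e := by positivity
      have h5 : 0 ≤ κ ^ 2 * |p - p'| := by positivity
      have h6 : 0 ≤ κ ^ 2 * e := by positivity
      rw [add_assoc |p - p'|, ← he]
      nlinarith

theorem measurableSet_label (y : ℤˣ) : MeasurableSet {z : Example d | z.2 = y} := by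
  have : {z : Example d | z.2 = y} = (fun z : Example d => (z.2 : ℤ)) ⁻¹' {(y : ℤ)} := by
    ext z
    simp [Units.ext_iff]
  rw [this]
  exact ((comap_measurable Units.val).comp measurable_snd) (measurableSet_singleton _)

theorem Measurable.surrogateGrad {α : Type*} [MeasurableSpace α] {p : α → ℝ} {u v w : α → Vec d}
    {z : α → Example d} (hp : Measurable p) (hu : Measurable u) (hv : Measurable v)
    (hz : Measurable z) (hw : Measurable w) :
    Measurable fun x => surrogateGrad (p x) (u x) (v x) (z x) (w x) := by
  unfold SPAUC.surrogateGrad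
  have h1 := hz (measurableSet_label 1)
  have h2 := hz (measurableSet_label (-1))
  have hx : Measurable fun x => (z x).1 := measurable_fst.comp hz
  refine (((Measurable.ite h1 ?_ measurable_const).add
    (Measurable.ite h2 ?_ measurable_const)).add ?_).add ?_
  all_goals fun_prop

theorem measurable_surrogate (p : ℝ) (u v w : Vec d) :
    Measurable fun z : Example d => surrogate p u v z w := by
  unfold SPAUC.surrogate
  refine ((((Measurable.ite (measurableSet_label 1) ?_ measurable_const).add
    (Measurable.ite (measurableSet_label (-1)) ?_ measurable_const)).add ?_).add ?_).add ?_
  all_goals fun_prop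

end Surrogate

/-! ### The risk as the mean of the population surrogate. -/

section Risk

variable {d : ℕ} {ρ : Measure (Example d)}

/-- The conditional mean `E[x | y]`. -/
noncomputable def condMean (ρ : Measure (Example d)) (y : ℤˣ) : Vec d :=
  (ρ.real {z | z.2 = y})⁻¹ • ∫ z in {z | z.2 = y}, z.1 ∂ρ

/-- The gradient of the surrogate function with the population values of `p, u, v`. -/
noncomputable def idealGrad (ρ : Measure (Example d)) (z : Example d) (w : Vec d) : Vec d :=
  surrogateGrad (posProb ρ) (condMean ρ 1) (condMean ρ (-1)) z w

/-- The expected gradient of the population surrogate. -/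
noncomputable def riskGrad (ρ : Measure (Example d)) (w : Vec d) : Vec d :=
  ∫ z, idealGrad ρ z w ∂ρ

theorem setOf_label_neg_one : {z : Example d | z.2 = -1} = {z | z.2 = 1}ᶜ := by
  ext z
  rcases Int.units_eq_one_or z.2 with h | h <;> simp [h]

theorem posProb_nonneg (ρ : Measure (Example d)) : 0 ≤ posProb ρ := measureReal_nonneg

theorem posProb_le_one (ρ : Measure (Example d)) [IsProbabilityMeasure ρ] : posProb ρ ≤ 1 :=
  measureReal_le_one

theorem measureReal_label_neg_one (ρ : Measure (Example d)) [IsProbabilityMeasure ρ] :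
    ρ.real {z | z.2 = -1} = 1 - posProb ρ := by
  rw [setOf_label_neg_one, probReal_compl_eq_one_sub (measurableSet_label 1), posProb]

theorem setIntegral_fst {y : ℤˣ} (hy : 0 < ρ.real {z : Example d | z.2 = y}) :
    ∫ z in {z | z.2 = y}, z.1 ∂ρ = ρ.real {z : Example d | z.2 = y} • condMean ρ y := by
  rw [condMean, smul_inv_smul₀ hy.ne']

theorem measurable_idealGrad (w : Vec d) : Measurable fun z => idealGrad ρ z w :=
  Measurable.surrogateGrad measurable_const measurable_const measurable_const measurable_id
    measurable_const

variable [IsProbabilityMeasure ρ] {κ : ℝ}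

theorem integrable_fst (hκ : ∀ᵐ z ∂ρ, ‖z.1‖ ≤ κ) : Integrable (fun z : Example d => z.1) ρ :=
  Integrable.of_bound measurable_fst.aestronglyMeasurable κ hκ

theorem norm_condMean_le (hκ0 : 0 ≤ κ) (hκ : ∀ᵐ z ∂ρ, ‖z.1‖ ≤ κ) (y : ℤˣ) :
    ‖condMean ρ y‖ ≤ κ := by
  have h := norm_setIntegral_le_of_norm_le_const_ae (μ := ρ) (s := {z | z.2 = y})
    (f := fun z : Example d => z.1) (C := κ) (measure_lt_top _ _) (ae_restrict_of_ae hκ)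
  rw [condMean, norm_smul, norm_inv, Real.norm_of_nonneg measureReal_nonneg]
  rcases (measureReal_nonneg (μ := ρ) (s := {z | z.2 = y})).eq_or_lt with h0 | h0
  · rw [← h0, inv_zero, zero_mul]; exact hκ0
  · rw [inv_mul_le_iff₀ h0, mul_comm]; exact h

theorem integrable_inner_fst (hκ : ∀ᵐ z ∂ρ, ‖z.1‖ ≤ κ) (w : Vec d) :
    Integrable (fun z : Example d => inner ℝ w z.1) ρ :=
  (integrable_fst hκ).const_inner w

theorem integrable_inner_fst_sq (hκ : ∀ᵐ z ∂ρ, ‖z.1‖ ≤ κ) (w : Vec d) :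
    Integrable (fun z : Example d => inner ℝ w z.1 ^ 2) ρ := by
  refine Integrable.of_bound (Measurable.aestronglyMeasurable (by fun_prop))
    ((‖w‖ * κ) ^ 2) (hκ.mono fun z hz => ?_)
  rw [norm_pow]
  exact pow_le_pow_left₀ (norm_nonneg _) ((norm_inner_le_norm _ _).trans (by gcongr)) 2

theorem setIntegral_inner_fst (hκ : ∀ᵐ z ∂ρ, ‖z.1‖ ≤ κ) {y : ℤˣ}
    (hy : 0 < ρ.real {z : Example d | z.2 = y}) (w : Vec d) :
    ∫ z in {z | z.2 = y}, inner ℝ w z.1 ∂ρ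
      = ρ.real {z : Example d | z.2 = y} * inner ℝ w (condMean ρ y) := by
  rw [integral_inner (integrable_fst hκ).integrableOn, setIntegral_fst hy, inner_smul_right]

theorem setIntegral_quadratic (hκ : ∀ᵐ z ∂ρ, ‖z.1‖ ≤ κ) {y : ℤˣ}
    (hy : 0 < ρ.real {z : Example d | z.2 = y}) (w : Vec d) (a b c : ℝ) :
    ∫ z in {z | z.2 = y}, (a * inner ℝ w z.1 ^ 2 + b * inner ℝ w z.1 + c) ∂ρ
      = a * ∫ z in {z | z.2 = y}, inner ℝ w z.1 ^ 2 ∂ρ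
        + b * (ρ.real {z : Example d | z.2 = y} * inner ℝ w (condMean ρ y))
        + ρ.real {z : Example d | z.2 = y} * c := by
  have h1 := ((integrable_inner_fst_sq hκ w).const_mul a).integrableOn (s := {z | z.2 = y})
  have h2 := ((integrable_inner_fst hκ w).const_mul b).integrableOn (s := {z | z.2 = y})
  have h12 : Integrable (fun z : Example d => a * inner ℝ w z.1 ^ 2 + b * inner ℝ w z.1)
      (ρ.restrict {z | z.2 = y}) := h1.add h2
  rw [integral_add h12 (integrable_const _), integral_add h1 h2, integral_const_mul,
    integral_const_mul, setIntegral_inner_fst hκ hy, setIntegral_const, smul_eq_mul]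

theorem integrable_surrogate (hκ1 : 1 ≤ κ) (hκ : ∀ᵐ z ∂ρ, ‖z.1‖ ≤ κ) (w : Vec d) : Integrable
    (fun z => surrogate (posProb ρ) (condMean ρ 1) (condMean ρ (-1)) z w) ρ := by
  refine Integrable.of_bound (measurable_surrogate _ _ _ _).aestronglyMeasurable
    (4 * κ ^ 2 * (1 + ‖w‖) ^ 2) (hκ.mono fun z hz => ?_)
  have h1 := zero_le_one.trans hκ1
  rw [Real.norm_of_nonneg (surrogate_nonneg (posProb_nonneg ρ) (posProb_le_one ρ) _ _ _ _)]
  exact surrogate_le (posProb_nonneg ρ) (posProb_le_one ρ) (norm_condMean_le h1 hκ _)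
    (norm_condMean_le h1 hκ _) hz hκ1 w

/-- The factor p(1 - p) is exactly the mass of the conditioning event. -/
theorem risk_eq_setIntegral (hp0 : 0 < posProb ρ) (hp1 : posProb ρ < 1) (w : Vec d) :
    risk ρ w = ∫ zz in {z | z.2 = 1} ×ˢ {z | z.2 = -1},
      (1 - inner ℝ w (zz.1.1 - zz.2.1)) ^ 2 ∂(ρ.prod ρ) := by
  have hset : {zz : Example d × Example d | zz.1.2 = 1 ∧ zz.2.2 = -1}
      = {z | z.2 = 1} ×ˢ {z | z.2 = -1} := rfl
  have hmass : (ρ.prod ρ ({z | z.2 = 1} ×ˢ {z | z.2 = -1})).toReal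
      = posProb ρ * (1 - posProb ρ) := by
    rw [Measure.prod_prod, ENNReal.toReal_mul, ← measureReal_label_neg_one]
    rfl
  have h0 : posProb ρ * (1 - posProb ρ) ≠ 0 := (mul_pos hp0 (sub_pos.2 hp1)).ne'
  rw [risk, hset, ProbabilityTheory.cond, integral_smul_measure, ENNReal.toReal_inv, hmass,
    smul_eq_mul, mul_inv_cancel_left₀ h0]

/-- Both sides are polynomials in p, the conditional means U, V of ⟨w, x⟩ and its second moments Q₁,
Q₂ over the two label sets. The coupling of x and x' in the risk is only through a product of first
moments, which is why a single example suffices once p, u, v are known. -/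
theorem risk_eq_integral_surrogate (hκ : ∀ᵐ z ∂ρ, ‖z.1‖ ≤ κ) (hp0 : 0 < posProb ρ)
    (hp1 : posProb ρ < 1) (w : Vec d) :
    risk ρ w = ∫ z, surrogate (posProb ρ) (condMean ρ 1) (condMean ρ (-1)) z w ∂ρ := by
  have hA : 0 < ρ.real {z : Example d | z.2 = 1} := hp0
  have hB : 0 < ρ.real {z : Example d | z.2 = -1} := by
    rw [measureReal_label_neg_one]; linarith
  have hB' := measureReal_label_neg_one ρ
  have hA' : ρ.real {z : Example d | z.2 = 1} = posProb ρ := rfl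
  have i1 := integrable_inner_fst hκ w
  have i2 := integrable_inner_fst_sq hκ w
  set p := posProb ρ with hp
  set U := inner ℝ w (condMean ρ 1) with hU
  set V := inner ℝ w (condMean ρ (-1)) with hV
  set Q₁ := ∫ z in {z : Example d | z.2 = 1}, inner ℝ w z.1 ^ 2 ∂ρ with hQ₁
  set Q₂ := ∫ z in {z : Example d | z.2 = -1}, inner ℝ w z.1 ^ 2 ∂ρ with hQ₂
  have hL : risk ρ w = (Q₁ - 2 * (p * U) + p) * (1 - p) + (p - p * U) * (2 * ((1 - p) * V))
      + p * Q₂ := by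
    -- Splitting the square into products of a function of the first example and one of the second
    -- lets Fubini evaluate each term separately.
    have e : ∀ zz : Example d × Example d, (1 - inner ℝ w (zz.1.1 - zz.2.1)) ^ 2
        = ((1 * inner ℝ w zz.1.1 ^ 2 + (-2) * inner ℝ w zz.1.1 + 1) * 1
          + (0 * inner ℝ w zz.1.1 ^ 2 + (-1) * inner ℝ w zz.1.1 + 1)
            * (0 * inner ℝ w zz.2.1 ^ 2 + 2 * inner ℝ w zz.2.1 + 0))
          + 1 * (1 * inner ℝ w zz.2.1 ^ 2 + 0 * inner ℝ w zz.2.1 + 0) := by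
      intro zz
      rw [inner_sub_right]
      ring
    have iq : ∀ (s : Set (Example d)) (a b c : ℝ), Integrable
        (fun z : Example d => a * inner ℝ w z.1 ^ 2 + b * inner ℝ w z.1 + c) (ρ.restrict s) :=
      fun s a b c => (((i2.const_mul a).add (i1.const_mul b)).add
        (integrable_const c)).integrableOn
    have ic : ∀ (s : Set (Example d)), Integrable (fun _ : Example d => (1 : ℝ)) (ρ.restrict s) :=
      fun s => integrable_const 1
    rw [risk_eq_setIntegral hp0 hp1, ← Measure.prod_restrict]
    rw [integral_congr_ae (Filter.Eventually.of_forall e)]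
    have j1 := (iq {z | z.2 = 1} 1 (-2) 1).mul_prod (ic {z | z.2 = -1})
    have j2 := (iq {z | z.2 = 1} 0 (-1) 1).mul_prod (iq {z | z.2 = -1} 0 2 0)
    have j3 := (ic {z | z.2 = 1}).mul_prod (iq {z | z.2 = -1} 1 0 0)
    have k1 := integral_prod_mul (μ := ρ.restrict {z | z.2 = 1})
      (ν := ρ.restrict {z | z.2 = -1})
      (fun z : Example d => 1 * inner ℝ w z.1 ^ 2 + (-2) * inner ℝ w z.1 + 1)
      (fun _ : Example d => (1 : ℝ))
    have k2 := integral_prod_mul (μ := ρ.restrict {z | z.2 = 1})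
      (ν := ρ.restrict {z | z.2 = -1})
      (fun z : Example d => 0 * inner ℝ w z.1 ^ 2 + (-1) * inner ℝ w z.1 + 1)
      (fun z : Example d => 0 * inner ℝ w z.1 ^ 2 + 2 * inner ℝ w z.1 + 0)
    have k3 := integral_prod_mul (μ := ρ.restrict {z | z.2 = 1})
      (ν := ρ.restrict {z | z.2 = -1}) (fun _ : Example d => (1 : ℝ))
      (fun z : Example d => 1 * inner ℝ w z.1 ^ 2 + 0 * inner ℝ w z.1 + 0)
    refine (integral_add' (j1.add j2) j3).trans ?_
    rw [integral_add' j1 j2, k1, k2, k3,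
      setIntegral_quadratic hκ hB, setIntegral_quadratic hκ hB,
      setIntegral_quadratic hκ hA, setIntegral_quadratic hκ hA,
      setIntegral_const, setIntegral_const, hA', hB', smul_eq_mul, smul_eq_mul]
    ring
  have hR : ∫ z, surrogate p (condMean ρ 1) (condMean ρ (-1)) z w ∂ρ
      = ((1 - p) * Q₁ - 2 * (1 - p) * U * (p * U)
        + p * ((1 - p) * U ^ 2 + p * (1 - p) * (1 + V - U) ^ 2))
        + (p * Q₂ - 2 * p * V * ((1 - p) * V)
        + (1 - p) * (p * V ^ 2 + p * (1 - p) * (1 + V - U) ^ 2)) := by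
    have c1 : ∫ z in {z | z.2 = 1}, surrogate p (condMean ρ 1) (condMean ρ (-1)) z w ∂ρ
        = ∫ z in {z : Example d | z.2 = 1}, ((1 - p) * inner ℝ w z.1 ^ 2
          + (-2 * (1 - p) * U) * inner ℝ w z.1
          + ((1 - p) * U ^ 2 + p * (1 - p) * (1 + V - U) ^ 2)) ∂ρ := by
      refine setIntegral_congr_fun (measurableSet_label 1) fun z hz => ?_
      have hz' : z.2 = 1 := hz
      simp only [surrogate, hz', if_true, show ¬((1 : ℤˣ) = -1) by decide, if_false,
        inner_sub_right, ← hU, ← hV]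
      ring
    have c2 : ∫ z in {z | z.2 = -1}, surrogate p (condMean ρ 1) (condMean ρ (-1)) z w ∂ρ
        = ∫ z in {z : Example d | z.2 = -1}, (p * inner ℝ w z.1 ^ 2
          + (-2 * p * V) * inner ℝ w z.1
          + (p * V ^ 2 + p * (1 - p) * (1 + V - U) ^ 2)) ∂ρ := by
      refine setIntegral_congr_fun (measurableSet_label (-1)) fun z hz => ?_
      have hz' : z.2 = -1 := hz
      simp only [surrogate, hz', if_true, show ¬((-1 : ℤˣ) = 1) by decide, if_false,
        inner_sub_right, ← hU, ← hV]
      ring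
    have hint : Integrable
        (fun z => surrogate p (condMean ρ 1) (condMean ρ (-1)) z w) ρ :=
      integrable_surrogate (le_max_left 1 κ)
        (hκ.mono fun z hz => hz.trans (le_max_right _ _)) w
    rw [← integral_add_compl (measurableSet_label 1) hint, ← setOf_label_neg_one, c1, c2,
      setIntegral_quadratic hκ hA, setIntegral_quadratic hκ hB, hA', hB']
    ring
  rw [hL, hR]
  ring

theorem norm_idealGrad_le (hκ1 : 1 ≤ κ) (hκ : ∀ᵐ z ∂ρ, ‖z.1‖ ≤ κ) (w : Vec d) :
    ∀ᵐ z ∂ρ, ‖idealGrad ρ z w‖ ≤ 8 * κ ^ 2 * (1 + ‖w‖) := by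
  have h1 := zero_le_one.trans hκ1
  exact hκ.mono fun z hz => norm_surrogateGrad_le (posProb_nonneg ρ) (posProb_le_one ρ)
    (norm_condMean_le h1 hκ _) (norm_condMean_le h1 hκ _) hz hκ1 w

theorem integrable_idealGrad (hκ1 : 1 ≤ κ) (hκ : ∀ᵐ z ∂ρ, ‖z.1‖ ≤ κ) (w : Vec d) : Integrable (fun z => idealGrad ρ z w) ρ :=
  Integrable.of_bound (measurable_idealGrad w).aestronglyMeasurable _
    (norm_idealGrad_le hκ1 hκ w)

/-- The subgradient inequality of the surrogate holds for each z and is integrated, so no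
differentiation under the integral is needed. -/
theorem risk_add_inner_le (hκ1 : 1 ≤ κ) (hκ : ∀ᵐ z ∂ρ, ‖z.1‖ ≤ κ)
    (hp0 : 0 < posProb ρ) (hp1 : posProb ρ < 1) (w v : Vec d) :
    risk ρ w + inner ℝ (riskGrad ρ w) (v - w) ≤ risk ρ v := by
  have i1 := integrable_surrogate hκ1 hκ w
  have i2 := integrable_surrogate hκ1 hκ v
  have i3 := (integrable_idealGrad hκ1 hκ w).const_inner (𝕜 := ℝ) (v - w)
  rw [risk_eq_integral_surrogate hκ hp0 hp1, risk_eq_integral_surrogate hκ hp0 hp1, riskGrad,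
    real_inner_comm, ← integral_inner (integrable_idealGrad hκ1 hκ w), ← integral_add i1 i3]
  refine integral_mono (i1.add i3) i2 fun z => ?_
  have := surrogate_add_inner_le hp0.le hp1.le (condMean ρ 1) (condMean ρ (-1)) z w v
  rwa [real_inner_comm] at this

theorem objective_subgradient (hκ1 : 1 ≤ κ) (hκ : ∀ᵐ z ∂ρ, ‖z.1‖ ≤ κ)
    (hp0 : 0 < posProb ρ) (hp1 : posProb ρ < 1) {reg : Vec d → ℝ}
    {reg' : Vec d → Vec d} (hreg' : ∀ w, IsSubgradientAt reg (reg' w) w) (w : Vec d) :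
    ∃ g, ∀ v, objective ρ reg w + inner ℝ g (v - w) ≤ objective ρ reg v := by
  refine ⟨riskGrad ρ w + reg' w, fun v => ?_⟩
  have h1 := risk_add_inner_le hκ1 hκ hp0 hp1 w v
  have h2 := hreg' w v
  rw [objective, objective, inner_add_left]
  linarith

end Risk

/-! ### Hoeffding bounds for independent sums and for martingales. -/

section Concentration

open scoped ENNReal

variable {E : Type*} [MeasurableSpace E] {ρ : Measure E}
  {S : Type*} [MeasurableSpace S] {P : Measure S} [IsProbabilityMeasure P] {z : ℕ → S → E}

/-- Each centred term is sub-Gaussian with variance proxy r², so the level r√(2tx) makes the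
Hoeffding exponent exactly -x for either sign. -/
theorem measure_abs_sum_sub_ge_le (hz : ∀ i, Measurable (z i)) (hlaw : ∀ i, P.map (z i) = ρ)
    (hind : iIndepFun z P) {g : E → ℝ} (hg : Measurable g) {r : ℝ} (hr0 : 0 < r)
    (hr : ∀ᵐ e ∂ρ, |g e| ≤ r) {t : ℕ} (ht : 1 ≤ t) {x : ℝ} (hx : 0 ≤ x) :
    P.real {s | r * √(2 * t * x) ≤ |∑ i ∈ Finset.range t, (g (z i s) - ∫ e, g e ∂ρ)|}
      ≤ 2 * Real.exp (-x) := by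
  have main : ∀ f : E → ℝ, Measurable f → (∀ᵐ e ∂ρ, |f e| ≤ r) →
      P.real {s | r * √(2 * t * x) ≤ ∑ i ∈ Finset.range t, (f (z i s) - ∫ e, f e ∂ρ)}
        ≤ Real.exp (-x) := by
    intro f hf hfr
    have hsub : ∀ i, HasSubgaussianMGF (fun s => f (z i s) - ∫ e, f e ∂ρ)
        ((‖r - -r‖₊ / 2) ^ 2) P := by
      intro i
      have h1 : ∀ᵐ s ∂P, f (z i s) ∈ Icc (-r) r := by
        rw [← hlaw i] at hfr
        exact (ae_of_ae_map (hz i).aemeasurable hfr).mono fun s hs => abs_le.1 hs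
      have h2 := hasSubgaussianMGF_of_mem_Icc (hf.comp (hz i)).aemeasurable h1
      have h3 : ∫ s, f (z i s) ∂P = ∫ e, f e ∂ρ := by
        rw [← hlaw i, integral_map (hz i).aemeasurable hf.aestronglyMeasurable]
      simpa only [Function.comp_apply, h3] using h2
    have hi : iIndepFun (fun i s => f (z i s) - ∫ e, f e ∂ρ) P :=
      hind.comp (fun _ e => f e - ∫ e, f e ∂ρ) fun _ => hf.sub_const _
    have h4 := HasSubgaussianMGF.measure_sum_ge_le_of_iIndepFun hi (s := Finset.range t)
      (fun i _ => hsub i) (ε := r * √(2 * t * x)) (by positivity)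
    refine h4.trans (le_of_eq ?_)
    congr 1
    have ht0 : (0 : ℝ) < t := by exact_mod_cast ht
    rw [Finset.sum_const, Finset.card_range, mul_pow, Real.sq_sqrt (by positivity)]
    simp only [nsmul_eq_mul, NNReal.coe_mul, NNReal.coe_natCast, NNReal.coe_pow, NNReal.coe_div,
      coe_nnnorm, NNReal.coe_ofNat, Real.norm_eq_abs, div_pow, sq_abs]
    field_simp
    ring
  have h1 := main g hg hr
  have h2 := main (fun e => -g e) hg.neg (by simpa only [abs_neg] using hr)
  have hsub : {s | r * √(2 * t * x) ≤ |∑ i ∈ Finset.range t, (g (z i s) - ∫ e, g e ∂ρ)|}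
      ⊆ {s | r * √(2 * t * x) ≤ ∑ i ∈ Finset.range t, (g (z i s) - ∫ e, g e ∂ρ)} ∪
        {s | r * √(2 * t * x) ≤ ∑ i ∈ Finset.range t, (-g (z i s) - ∫ e, -g e ∂ρ)} := by
    intro s hs
    rcases le_abs.1 (mem_ofPred_eq ▸ hs) with h | h
    · exact Or.inl h
    · refine Or.inr ?_
      rw [← Finset.sum_neg_distrib] at h
      simp only [mem_ofPred_eq, integral_neg]
      refine h.trans (le_of_eq (Finset.sum_congr rfl fun i _ => by ring))
  calc _ ≤ _ := measureReal_mono hsub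
    _ ≤ _ := measureReal_union_le _ _
    _ ≤ _ := by linarith

variable [IsProbabilityMeasure ρ]

/-- Hoeffding's lemma with proxy r². It is applied with the past frozen, so r may later depend on
the past. -/
theorem lintegral_exp_sub_le_one {g : E → ℝ} {r : ℝ} (hg : Measurable g)
    (hr : ∀ᵐ e ∂ρ, |g e| ≤ r) (c : ℝ) :
    ∫⁻ e, ENNReal.ofReal (Real.exp (c * (g e - ∫ e', g e' ∂ρ) - c ^ 2 * r ^ 2 / 2)) ∂ρ ≤ 1 := by
  have hs := hasSubgaussianMGF_of_mem_Icc (μ := ρ) (a := -r) (b := r) hg.aemeasurable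
    (hr.mono fun e he => abs_le.1 he)
  have h1 := hs.mgf_le c
  have h2 := hs.integrable_exp_mul c
  have e1 : ((((‖r - -r‖₊ / 2) ^ 2 : NNReal)) : ℝ) = r ^ 2 := by
    push_cast
    rw [Real.norm_eq_abs, div_pow, sq_abs]
    ring
  rw [e1, mgf] at h1
  simp_rw [Real.exp_sub, div_eq_mul_inv]
  rw [← ofReal_integral_eq_lintegral_ofReal (h2.mul_const _)
    (Filter.Eventually.of_forall fun e => by positivity), integral_mul_const, ← ENNReal.ofReal_one]
  refine ENNReal.ofReal_le_ofReal ?_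
  rw [← div_eq_mul_inv, div_le_one (Real.exp_pos _)]
  calc _ ≤ _ := h1
    _ = _ := by ring_nf

/-- The supermartingale property, by induction without a filtration: z_t is independent of the
earlier examples, so Fubini integrates the last factor alone, and that integral is at most 1. -/
theorem lintegral_prod_le_one [Nonempty E] (hz : ∀ i, Measurable (z i))
    (hlaw : ∀ i, P.map (z i) = ρ) (hind : iIndepFun z P) (G : ℕ → (ℕ → E) → E → ℝ≥0∞)
    (hG : ∀ k, Measurable fun he : (ℕ → E) × E => G k he.1 he.2)
    (hdep : ∀ k h h', (∀ i < k, h i = h' i) → G k h = G k h')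
    (hint : ∀ k h, ∫⁻ e, G k h e ∂ρ ≤ 1) (t : ℕ) :
    ∫⁻ s, ∏ k ∈ Finset.range t, G k (fun i => z i s) (z k s) ∂P ≤ 1 := by
  induction t with
  | zero => simp
  | succ t ih =>
    classical
    obtain ⟨e₀⟩ := ‹Nonempty E›
    -- The factors with index at most t read the history only before t, so a finite history may be
    -- completed by an arbitrary constant.
    let ext : (Finset.range t → E) → ℕ → E := fun x i =>
      if hi : i ∈ Finset.range t then x ⟨i, hi⟩ else e₀
    have hext : Measurable ext := by
      refine measurable_pi_iff.2 fun i => ?_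
      by_cases hi : i ∈ Finset.range t
      · simpa only [ext, hi, dif_pos] using measurable_pi_apply _
      · simp only [ext, hi, dif_neg, not_false_eq_true, measurable_const]
    let X : S → Finset.range t → E := fun s i => z i s
    have hX : Measurable X := measurable_pi_iff.2 fun i => hz i
    have hagree : ∀ s, ∀ i < t, ext (X s) i = z i s := fun s i hi => by
      simp [ext, X, hi]
    have hXz : IndepFun X (z t) P :=
      (hind.indepFun_finset (Finset.range t) {t} (by simp) hz).comp measurable_id
        (measurable_pi_apply (⟨t, by simp⟩ : ({t} : Finset ℕ)))
    let M : (Finset.range t → E) → ℝ≥0∞ := fun x =>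
      ∏ k ∈ Finset.range t, G k (ext x) (ext x k)
    have hM : Measurable M := Finset.measurable_prod _ fun k _ =>
      (hG k).comp (hext.prodMk ((measurable_pi_apply k).comp hext))
    have hMX : ∀ s, M (X s) = ∏ k ∈ Finset.range t, G k (fun i => z i s) (z k s) := fun s =>
      Finset.prod_congr rfl fun k hk => by
        rw [hagree s k (Finset.mem_range.1 hk), hdep k _ _ fun i hi =>
          hagree s i (hi.trans (Finset.mem_range.1 hk))]
    have hF : Measurable fun xe : (Finset.range t → E) × E => M xe.1 * G t (ext xe.1) xe.2 :=
      (hM.comp measurable_fst).mul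
        ((hG t).comp ((hext.comp measurable_fst).prodMk measurable_snd))
    have hprod := (indepFun_iff_map_prod_eq_prod_map_map hX.aemeasurable (hz t).aemeasurable).1 hXz
    calc ∫⁻ s, ∏ k ∈ Finset.range (t + 1), G k (fun i => z i s) (z k s) ∂P
        = ∫⁻ s, M (X s) * G t (ext (X s)) (z t s) ∂P := by
          refine lintegral_congr fun s => ?_
          rw [Finset.prod_range_succ, hMX, hdep t _ _ (hagree s)]
      _ = ∫⁻ xe, M xe.1 * G t (ext xe.1) xe.2 ∂((P.map X).prod (P.map (z t))) := by
          rw [← hprod, lintegral_map hF (hX.prodMk (hz t))]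
      _ = ∫⁻ x, ∫⁻ e, M x * G t (ext x) e ∂ρ ∂(P.map X) := by
          rw [hlaw, lintegral_prod _ hF.aemeasurable]
      _ ≤ ∫⁻ x, M x ∂(P.map X) := by
          refine lintegral_mono fun x => ?_
          have hGx : Measurable fun e => G t (ext x) e := (hG t).comp measurable_prodMk_left
          rw [lintegral_const_mul _ hGx]
          exact mul_le_of_le_one_right' (hint t _)
      _ = ∫⁻ s, ∏ k ∈ Finset.range t, G k (fun i => z i s) (z k s) ∂P := by
          rw [lintegral_map hM hX]
          exact lintegral_congr hMX
      _ ≤ 1 := ih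

/-- A Hoeffding inequality for martingale differences with predictable ranges. -/
theorem measure_martingale_sum_ge_le [Nonempty E] (hz : ∀ i, Measurable (z i))
    (hlaw : ∀ i, P.map (z i) = ρ) (hind : iIndepFun z P) (g : ℕ → (ℕ → E) → E → ℝ)
    (r : ℕ → (ℕ → E) → ℝ) (hg : ∀ k, Measurable fun he : (ℕ → E) × E => g k he.1 he.2)
    (hr : ∀ k, Measurable (r k)) (hgdep : ∀ k h h', (∀ i < k, h i = h' i) → g k h = g k h')
    (hrdep : ∀ k h h', (∀ i < k, h i = h' i) → r k h = r k h')
    (hgr : ∀ k h, ∀ᵐ e ∂ρ, |g k h e| ≤ r k h) (c : ℕ → ℝ) (t : ℕ) (x : ℝ) :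
    P.real {s | x ≤ ∑ k ∈ Finset.range t,
      (c k * (g k (fun i => z i s) (z k s) - ∫ e, g k (fun i => z i s) e ∂ρ)
        - c k ^ 2 * r k (fun i => z i s) ^ 2 / 2)} ≤ Real.exp (-x) := by
  have hmean : ∀ k, Measurable fun h => ∫ e, g k h e ∂ρ := fun k =>
    ((hg k).stronglyMeasurable.integral_prod_right' (ν := ρ)).measurable
  let G : ℕ → (ℕ → E) → E → ℝ≥0∞ := fun k h e => ENNReal.ofReal
    (Real.exp (c k * (g k h e - ∫ e', g k h e' ∂ρ) - c k ^ 2 * r k h ^ 2 / 2))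
  have hG : ∀ k, Measurable fun he : (ℕ → E) × E => G k he.1 he.2 := fun k =>
    ENNReal.measurable_ofReal.comp (Real.measurable_exp.comp
      ((((hg k).sub ((hmean k).comp measurable_fst)).const_mul _).sub
        (((((hr k).comp measurable_fst).pow_const 2).const_mul _).div_const 2)))
  have hpath : Measurable fun s => fun i => z i s := measurable_pi_iff.2 hz
  have key := lintegral_prod_le_one hz hlaw hind G hG
    (fun k h h' hh => by simp only [G]; rw [hgdep k h h' hh, hrdep k h h' hh])
    (fun k h => lintegral_exp_sub_le_one ((hg k).comp measurable_prodMk_left) (hgr k h) (c k)) t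
  have hmeas : Measurable fun s => ∏ k ∈ Finset.range t, G k (fun i => z i s) (z k s) :=
    Finset.measurable_prod _ fun k _ => (hG k).comp (hpath.prodMk (hz k))
  -- Markov's inequality at level exp x for the product of exponentials.
  have hmk := mul_meas_ge_le_lintegral hmeas (μ := P) (ENNReal.ofReal (Real.exp x))
  have hset : {s | ENNReal.ofReal (Real.exp x)
      ≤ ∏ k ∈ Finset.range t, G k (fun i => z i s) (z k s)} = {s | x ≤ ∑ k ∈ Finset.range t,
      (c k * (g k (fun i => z i s) (z k s) - ∫ e, g k (fun i => z i s) e ∂ρ)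
        - c k ^ 2 * r k (fun i => z i s) ^ 2 / 2)} := by
    ext s
    simp only [G, mem_ofPred_eq]
    rw [← ENNReal.ofReal_prod_of_nonneg fun _ _ => (Real.exp_pos _).le, ← Real.exp_sum,
      ENNReal.ofReal_le_ofReal_iff (Real.exp_pos _).le, Real.exp_le_exp]
  rw [hset] at hmk
  have h3 := ENNReal.toReal_mono ENNReal.one_ne_top (hmk.trans key)
  rw [ENNReal.toReal_mul, ENNReal.toReal_ofReal (Real.exp_pos _).le, ENNReal.toReal_one] at h3
  rw [Real.exp_neg, ← one_div, le_div_iff₀ (Real.exp_pos _), mul_comm]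
  exact h3

end Concentration

/-! ### The iterates as measurable, predictable functions of the examples. -/

section Iterates

variable {d : ℕ}

/-- The iterates of SPAUC as functions of the sequence of examples. -/
noncomputable def iterates (reg : Vec d → ℝ) (η : ℕ → ℝ) : ℕ → (ℕ → Example d) → Vec d
  | 0, _ => 0
  | 1, _ => 0
  | t + 2, z => prox (fun v => η (t + 1) * reg v) (iterates reg η (t + 1) z
      - η (t + 1) • stochGrad z (t + 1) (iterates reg η (t + 1) z))

theorem IsSPAUC.eq_iterates {reg : Vec d → ℝ} (hreg : ConvexOn ℝ univ reg)
    (hreg0 : ∀ v, 0 ≤ reg v) {η : ℕ → ℝ} (hη : ∀ t, 0 ≤ η t) {z : ℕ → Example d}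
    {w : ℕ → Vec d} (h : IsSPAUC reg η z w) {t : ℕ} (ht : 1 ≤ t) : w t = iterates reg η t z := by
  induction t, ht using Nat.le_induction with
  | base => exact h.1
  | succ t ht ih =>
    obtain ⟨t, rfl⟩ := Nat.exists_eq_add_of_le' ht
    have hc : ConvexOn ℝ univ fun v => η (t + 1) * reg v := by simpa using hreg.smul (hη (t + 1))
    rw [(h.isProx hreg hη ht).eq_prox hc fun v => mul_nonneg (hη _) (hreg0 v), ih]
    rfl

theorem labelCount_congr {z z' : ℕ → Example d} {t : ℕ} (h : ∀ i < t, z i = z' i) (y : ℤˣ) :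
    labelCount z y t = labelCount z' y t :=
  Finset.sum_congr rfl fun i hi => by rw [h i (Finset.mem_range.1 hi)]

theorem labelMean_congr {z z' : ℕ → Example d} {t : ℕ} (h : ∀ i < t, z i = z' i) (y : ℤˣ) :
    labelMean z y t = labelMean z' y t := by
  rw [labelMean, labelMean, labelCount_congr h]
  congr 1
  exact Finset.sum_congr rfl fun i hi => by rw [h i (Finset.mem_range.1 hi)]

/-- Predictability: step t produces w_{t+1} from z_0, …, z_t, so w_t does not see z_t. This is what
makes the noise centred given the past. -/
theorem iterates_congr (reg : Vec d → ℝ) (η : ℕ → ℝ) (t : ℕ) {z z' : ℕ → Example d}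
    (h : ∀ i < t, z i = z' i) : iterates reg η t z = iterates reg η t z' := by
  induction t using Nat.twoStepInduction with
  | zero => rfl
  | one => rfl
  | more t _ ih =>
    have h' : ∀ i < t + 1, z i = z' i := fun i hi => h i (by omega)
    simp only [iterates, ih h', stochGrad, empProb, labelCount_congr h', labelMean_congr h',
      h (t + 1) (by omega)]

theorem measurable_label_apply (i : ℕ) (y : ℤˣ) :
    MeasurableSet {z : ℕ → Example d | (z i).2 = y} :=
  measurable_pi_apply (X := fun _ : ℕ => Example d) i (measurableSet_label y)

theorem measurable_labelCount (y : ℤˣ) (t : ℕ) :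
    Measurable fun z : ℕ → Example d => labelCount z y t :=
  Finset.measurable_sum _ fun i _ =>
    Measurable.ite (measurable_label_apply i y) measurable_const measurable_const

theorem measurable_labelMean (y : ℤˣ) (t : ℕ) :
    Measurable fun z : ℕ → Example d => labelMean z y t :=
  (measurable_labelCount y t).inv.smul (Finset.measurable_sum _ fun i _ =>
    Measurable.ite (measurable_label_apply i y) (measurable_fst.comp (measurable_pi_apply i))
      measurable_const)

theorem measurable_iterates {reg : Vec d → ℝ} (hreg : ConvexOn ℝ univ reg)
    (hreg0 : ∀ v, 0 ≤ reg v) {η : ℕ → ℝ} (hη : ∀ t, 0 ≤ η t) (t : ℕ) :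
    Measurable (iterates reg η t) := by
  induction t using Nat.twoStepInduction with
  | zero => exact measurable_const
  | one => exact measurable_const
  | more t _ ih =>
    have hc : ConvexOn ℝ univ fun v => η (t + 1) * reg v := by simpa using hreg.smul (hη (t + 1))
    have h1 : Measurable fun z => stochGrad z (t + 1) (iterates reg η (t + 1) z) :=
      Measurable.surrogateGrad ((measurable_labelCount 1 _).div_const _) (measurable_labelMean 1 _)
        (measurable_labelMean (-1) _) (measurable_pi_apply _) ih
    have h2 : Measurable fun z => η (t + 1) • stochGrad z (t + 1) (iterates reg η (t + 1) z) :=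
      h1.const_smul (η (t + 1))
    exact (continuous_prox hc fun v => mul_nonneg (hη _) (hreg0 v)).measurable.comp (ih.sub h2)

end Iterates

/-! ### Solving the weighted recursion. -/

section Recursion

theorem sum_Icc_inv_le (t : ℕ) : ∑ k ∈ Finset.Icc 1 t, ((k : ℝ))⁻¹ ≤ 1 + Real.log t := by
  have h := harmonic_le_one_add_log t
  rw [harmonic_eq_sum_Icc] at h
  push_cast at h
  exact h

theorem two_mul_sqrt_mul_le {σ D m : ℝ} (hσ : 0 < σ) (hD : 0 ≤ D) (hm : 0 ≤ m) :
    2 * √(D * m) ≤ σ * D / 2 + 2 * m / σ := by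
  have h : √(D * m) ≤ σ * D / 4 + m / σ := by
    refine Real.sqrt_le_iff.2 ⟨by positivity, ?_⟩
    have : (σ * D / 4 + m / σ) ^ 2 = D * m + (σ * D / 4 - m / σ) ^ 2 := by
      field_simp
      ring
    nlinarith [sq_nonneg (σ * D / 4 - m / σ)]
  have h2 : σ * D / 2 + 2 * m / σ = 2 * (σ * D / 4 + m / σ) := by ring
  linarith

/-- Multiplication by s(s - 1) turns the descent term into -(4/σ)(s - 1)h. Three quarters of it
yield -3(s - 1)D by quadratic growth, while the bias costs (s - 1)D by the arithmetic–geometric mean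
inequality. Since s + 1 - 3 = s - 2, the coefficient of D becomes (s - 1)(s - 2), the weight of the
previous step, and (1/σ)(s - 1)h is left over. -/
theorem weighted_step {σ s k t₁ M D D' h ξ : ℝ} (hσ : 0 < σ) (hk : 1 ≤ k) (hsk : k ≤ s)
    (hst : s ≤ k + t₁ + 2) (hM : 0 ≤ M) (hD : 0 ≤ D) (hDh : σ * D ≤ h)
    (hstep : D' ≤ D + 2 * (2 / (σ * s)) * (-h + ξ + √(D * (M / k))) + (2 / (σ * s)) ^ 2 * M) :
    s * (s - 1) * D' ≤ (s - 1) * (s - 2) * D - 1 / σ * ((s - 1) * h) + 4 / σ * ((s - 1) * ξ)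
      + 8 * M / σ ^ 2 * (1 + (t₁ + 2) * k⁻¹) := by
  have hk0 : 0 < k := by linarith
  have hs0 : 0 < s := by linarith
  have hs1 : 0 ≤ s - 1 := by linarith
  have h1 := mul_le_mul_of_nonneg_left hstep (mul_nonneg hs0.le hs1)
  have h2 := mul_le_mul_of_nonneg_left
    (two_mul_sqrt_mul_le hσ hD (show 0 ≤ M / k by positivity)) (show 0 ≤ 2 * (s - 1) / σ by positivity)
  have e1 : s * (s - 1) * (D + 2 * (2 / (σ * s)) * (-h + ξ + √(D * (M / k)))
      + (2 / (σ * s)) ^ 2 * M) = s * (s - 1) * D - 4 / σ * ((s - 1) * h) + 4 / σ * ((s - 1) * ξ)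
      + 2 * (s - 1) / σ * (2 * √(D * (M / k))) + 4 * M / σ ^ 2 * ((s - 1) / s) := by
    field_simp
    ring
  have e2 : 2 * (s - 1) / σ * (σ * D / 2 + 2 * (M / k) / σ)
      = (s - 1) * D + 4 * M / σ ^ 2 * ((s - 1) * k⁻¹) := by
    field_simp
    ring
  have h3 : 3 * (s - 1) * D ≤ 3 / σ * ((s - 1) * h) := by
    have := mul_le_mul_of_nonneg_left hDh (show 0 ≤ 3 / σ * (s - 1) by positivity)
    have e : 3 / σ * (s - 1) * (σ * D) = 3 * (s - 1) * D := by field_simp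
    linarith
  have h4 : (s - 1) / s ≤ 1 := by rw [div_le_one hs0]; linarith
  have h5 : (s - 1) * k⁻¹ ≤ 1 + (t₁ + 2) * k⁻¹ := by
    have : (1 : ℝ) = k * k⁻¹ := (mul_inv_cancel₀ hk0.ne').symm
    rw [this, ← add_mul]
    exact mul_le_mul_of_nonneg_right (by linarith) (by positivity)
  have h7 : 0 ≤ (t₁ + 2) * k⁻¹ := mul_nonneg (by linarith) (by positivity)
  have h6 := mul_le_mul_of_nonneg_left (show (s - 1) * k⁻¹ + (s - 1) / s
    ≤ 2 * (1 + (t₁ + 2) * k⁻¹) by linarith) (show 0 ≤ 4 * M / σ ^ 2 by positivity)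
  have e3 : 4 / σ * ((s - 1) * h) = 1 / σ * ((s - 1) * h) + 3 / σ * ((s - 1) * h) := by ring
  rw [e1] at h1
  rw [e2] at h2
  have e4 : 4 * M / σ ^ 2 * (2 * (1 + (t₁ + 2) * k⁻¹))
      = 8 * M / σ ^ 2 * (1 + (t₁ + 2) * k⁻¹) := by ring
  linarith

/-- The steps telescope to a bound with (1/σ)∑(k + t₁ + a - 1)h_k on the left. Half of this pays for
the variance of the noise, and half survives for the rate of the averages. -/
theorem recursion_bound {σ a t₁ M R x : ℝ} (hσ : 0 < σ) (ha0 : 0 ≤ a) (ha2 : a ≤ 2)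
    (ht₁ : 0 < t₁) (hM : 0 ≤ M) (hR : 0 < R) {T : ℕ} {D h ξ : ℕ → ℝ}
    (hD : ∀ k, 0 ≤ D k) (hDh : ∀ k, σ * D k ≤ h k)
    (hstep : ∀ k : ℕ, 1 ≤ k → k ≤ T → D (k + 1) ≤ D k
      + 2 * (2 / (σ * (k + t₁ + a))) * (-h k + ξ k + √(D k * (M / k)))
      + (2 / (σ * (k + t₁ + a))) ^ 2 * M) {t : ℕ} (ht : 1 ≤ t) (htT : t ≤ T)
    (hmart : ∑ k ∈ Finset.Icc 1 t, (σ / (4 * R * (t + t₁ + a)) * (k + t₁ + a - 1) * ξ k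
      - (σ / (4 * R * (t + t₁ + a)) * (k + t₁ + a - 1)) ^ 2 * (R * D k) / 2) ≤ x) :
    (t + t₁ + a) * (t + t₁ + a - 1) * D (t + 1)
      + 1 / (2 * σ) * ∑ k ∈ Finset.Icc 1 t, (k + t₁ + a - 1) * h k
      ≤ (t₁ + 2) ^ 2 * D 1 + 16 * x * R * (t + t₁ + a) / σ ^ 2
        + 8 * M / σ ^ 2 * ∑ k ∈ Finset.Icc 1 t, (1 + (t₁ + 2) * ((k : ℝ))⁻¹) := by
  have hsum : ∀ t : ℕ, t ≤ T → (t + t₁ + a) * (t + t₁ + a - 1) * D (t + 1)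
      + 1 / σ * ∑ k ∈ Finset.Icc 1 t, (k + t₁ + a - 1) * h k
      ≤ (t₁ + a) * (t₁ + a - 1) * D 1 + 4 / σ * ∑ k ∈ Finset.Icc 1 t, (k + t₁ + a - 1) * ξ k
        + 8 * M / σ ^ 2 * ∑ k ∈ Finset.Icc 1 t, (1 + (t₁ + 2) * ((k : ℝ))⁻¹) := by
    intro t htT
    induction t with
    | zero => simp
    | succ t ih =>
      have h1 := ih (by omega)
      have hst := hstep (t + 1) (by omega) htT
      have h2 := weighted_step (t₁ := t₁) hσ (k := ((t + 1 : ℕ) : ℝ))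
        (by push_cast; linarith [(Nat.cast_nonneg t : (0 : ℝ) ≤ t)])
        (by linarith) (by linarith) hM (hD (t + 1)) (hDh (t + 1)) hst
      simp only [Finset.sum_Icc_succ_top (show 1 ≤ t + 1 by omega), mul_add (1 / σ),
        mul_add (4 / σ), mul_add (8 * M / σ ^ 2)]
      push_cast at h2 ⊢
      have e : ((t : ℝ) + 1 + t₁ + a - 1) * (t + 1 + t₁ + a - 2) * D (t + 1)
          = (t + t₁ + a) * (t + t₁ + a - 1) * D (t + 1) := by ring
      rw [e] at h2
      linarith
  have h1 := hsum t htT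
  have ht0 : (1 : ℝ) ≤ t := by exact_mod_cast ht
  set s : ℝ := t + t₁ + a with hs
  have hs0 : 0 < s := by linarith
  -- With this value, λR times any weight up to time t is at most σ/4, so the compensator is at most
  -- λ/8 times the sum of weighted h_k. The choice depends on t, hence one exponential martingale
  -- for each t.
  set lam : ℝ := σ / (4 * R * s) with hlam
  have hlam0 : 0 < lam := by positivity
  have hvar : ∑ k ∈ Finset.Icc 1 t, (lam * (k + t₁ + a - 1)) ^ 2 * (R * D k) / 2
      ≤ lam * (1 / 8) * ∑ k ∈ Finset.Icc 1 t, (k + t₁ + a - 1) * h k := by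
    rw [Finset.mul_sum]
    refine Finset.sum_le_sum fun k hk => ?_
    obtain ⟨hk1, hkt⟩ := Finset.mem_Icc.1 hk
    have hk1' : (1 : ℝ) ≤ k := by exact_mod_cast hk1
    have hkt' : (k : ℝ) ≤ t := by exact_mod_cast hkt
    have ha : (0 : ℝ) ≤ k + t₁ + a - 1 := by linarith
    have has : (k : ℝ) + t₁ + a - 1 ≤ s := by linarith
    have e1 : lam * R * s = σ / 4 := by rw [hlam]; field_simp
    have h3 : (k + t₁ + a - 1) * (σ * D k) ≤ (k + t₁ + a - 1) * h k :=
      mul_le_mul_of_nonneg_left (hDh k) ha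
    calc (lam * (k + t₁ + a - 1)) ^ 2 * (R * D k) / 2
        = lam / 2 * (lam * R * (k + t₁ + a - 1)) * ((k + t₁ + a - 1) * D k) := by ring
      _ ≤ lam / 2 * (lam * R * s) * ((k + t₁ + a - 1) * D k) := by
          have := mul_nonneg ha (hD k)
          gcongr
      _ = lam * (1 / 8) * ((k + t₁ + a - 1) * (σ * D k)) := by rw [e1]; ring
      _ ≤ _ := by gcongr
  rw [Finset.sum_sub_distrib] at hmart
  have e2 : ∑ k ∈ Finset.Icc 1 t, lam * (k + t₁ + a - 1) * ξ k
      = lam * ∑ k ∈ Finset.Icc 1 t, (k + t₁ + a - 1) * ξ k := by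
    rw [Finset.mul_sum]
    exact Finset.sum_congr rfl fun k _ => by ring
  rw [e2] at hmart
  set Ξ := ∑ k ∈ Finset.Icc 1 t, (k + t₁ + a - 1) * ξ k
  set H := ∑ k ∈ Finset.Icc 1 t, (k + t₁ + a - 1) * h k
  have h4 : Ξ ≤ x / lam + 1 / 8 * H := by
    have : lam * Ξ ≤ lam * (x / lam + 1 / 8 * H) := by
      rw [mul_add, mul_div_cancel₀ _ hlam0.ne']
      linarith
    exact le_of_mul_le_mul_left this hlam0
  have h5 := mul_le_mul_of_nonneg_left h4 (show 0 ≤ 4 / σ by positivity)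
  have e3 : 4 / σ * (x / lam + 1 / 8 * H) = 16 * x * R * s / σ ^ 2 + 1 / (2 * σ) * H := by
    rw [hlam]
    field_simp
    ring
  have e4 : 1 / σ * H = 1 / (2 * σ) * H + 1 / (2 * σ) * H := by field_simp; ring
  have h6 : (t₁ + a) * (t₁ + a - 1) * D 1 ≤ (t₁ + 2) ^ 2 * D 1 :=
    mul_le_mul_of_nonneg_right (by nlinarith) (hD 1)
  linarith

end Recursion

/-! ### Accuracy of the empirical label frequency and means. -/

section Empirical

variable {d : ℕ}

theorem labelCount_nonneg (z : ℕ → Example d) (y : ℤˣ) (t : ℕ) : 0 ≤ labelCount z y t :=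
  Finset.sum_nonneg fun i _ => by split_ifs <;> norm_num

theorem labelCount_add (z : ℕ → Example d) (t : ℕ) :
    labelCount z 1 t + labelCount z (-1) t = t := by
  rw [labelCount, labelCount, ← Finset.sum_add_distrib, Finset.sum_congr rfl (g := fun _ => (1 : ℝ))]
  · simp
  · intro i _
    rcases Int.units_eq_one_or (z i).2 with h | h <;> simp [h]

theorem empProb_nonneg (z : ℕ → Example d) (t : ℕ) : 0 ≤ empProb z t :=
  div_nonneg (labelCount_nonneg z 1 t) (Nat.cast_nonneg t)

theorem empProb_le_one (z : ℕ → Example d) (t : ℕ) : empProb z t ≤ 1 :=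
  div_le_one_of_le₀ (by linarith [labelCount_add z t, labelCount_nonneg z (-1) t])
    (Nat.cast_nonneg t)

/-- Multiplying by the count avoids the division, so the identity also covers a label not yet seen,
where both sides vanish. -/
theorem labelCount_smul_labelMean_sub (z : ℕ → Example d) (y : ℤˣ) (t : ℕ) (c : Vec d) :
    labelCount z y t • (labelMean z y t - c)
      = ∑ i ∈ Finset.range t, if (z i).2 = y then (z i).1 - c else 0 := by
  have e : ∑ i ∈ Finset.range t, (if (z i).2 = y then (z i).1 - c else 0)
      = (∑ i ∈ Finset.range t, if (z i).2 = y then (z i).1 else 0) - labelCount z y t • c := by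
    rw [labelCount, Finset.sum_smul, ← Finset.sum_sub_distrib]
    exact Finset.sum_congr rfl fun i _ => by split_ifs <;> simp
  by_cases h : labelCount z y t = 0
  · rw [h, zero_smul]
    symm
    have h0 := (Finset.sum_eq_zero_iff_of_nonneg
      (fun i _ => by split_ifs <;> norm_num)).1 h
    refine Finset.sum_eq_zero fun i hi => if_neg fun hy => ?_
    simpa [hy] using h0 i hi
  · rw [e, labelMean, smul_sub, smul_inv_smul₀ h]

theorem norm_labelMean_le {z : ℕ → Example d} {κ : ℝ} (hκ : 0 ≤ κ) (hz : ∀ i, ‖(z i).1‖ ≤ κ)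
    (y : ℤˣ) (t : ℕ) : ‖labelMean z y t‖ ≤ κ := by
  have h0 := labelCount_nonneg z y t
  rw [labelMean, norm_smul, norm_inv, Real.norm_of_nonneg h0]
  have h1 : ‖∑ i ∈ Finset.range t, if (z i).2 = y then (z i).1 else 0‖ ≤ labelCount z y t * κ := by
    refine (norm_sum_le _ _).trans ?_
    rw [labelCount, Finset.sum_mul]
    exact Finset.sum_le_sum fun i _ => by split_ifs <;> simp [hz i]
  rcases h0.eq_or_lt with h | h
  · rw [← h, inv_zero, zero_mul]; exact hκ
  · rwa [inv_mul_le_iff₀ h]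

theorem norm_le_card_mul {x : Vec d} {Δ : ℝ} (h : ∀ j, |x j| ≤ Δ) : ‖x‖ ≤ d * Δ := by
  have h1 : ‖x‖ ≤ ∑ j, |x j| := by
    conv_lhs => rw [← (EuclideanSpace.basisFun (Fin d) ℝ).sum_repr x]
    refine (norm_sum_le _ _).trans (Finset.sum_le_sum fun j _ => ?_)
    simp [norm_smul]
  refine h1.trans ((Finset.sum_le_sum fun j _ => h j).trans ?_)
  simp

/-- The scores whose averages control the deviations of the empirical means. -/
noncomputable def centredScore (ρ : Measure (Example d)) (y : ℤˣ) (j : Fin d) (e : Example d) : ℝ :=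
  if e.2 = y then (e.1 - condMean ρ y) j else 0

/-- The indicator of the positive label. -/
noncomputable def posIndicator (e : Example d) : ℝ := if e.2 = 1 then 1 else 0

theorem measurable_centredScore (ρ : Measure (Example d)) (y : ℤˣ) (j : Fin d) :
    Measurable (centredScore ρ y j) :=
  Measurable.ite (measurableSet_label y) (by fun_prop) measurable_const

theorem measurable_posIndicator : Measurable (posIndicator (d := d)) :=
  Measurable.ite (measurableSet_label 1) measurable_const measurable_const

theorem abs_posIndicator_le (e : Example d) : |posIndicator e| ≤ 1 := by
  rw [posIndicator]; split_ifs <;> simp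

theorem integral_posIndicator (ρ : Measure (Example d)) : ∫ e, posIndicator e ∂ρ = posProb ρ := by
  have : (posIndicator : Example d → ℝ) = {z : Example d | z.2 = 1}.indicator fun _ => (1 : ℝ) := by
    ext e
    simp [posIndicator, indicator_apply]
  rw [this, integral_indicator_const _ (measurableSet_label 1), posProb, smul_eq_mul, mul_one]

/-- The deviations of the empirical quantities at time `t` are at most `Δ`. -/
def SmallDeviation (ρ : Measure (Example d)) (z : ℕ → Example d) (t : ℕ) (Δ : ℝ) : Prop :=
  |∑ i ∈ Finset.range t, (posIndicator (z i) - posProb ρ)| ≤ Δ ∧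
    ∀ y j, |∑ i ∈ Finset.range t, centredScore ρ y j (z i)| ≤ Δ

theorem SmallDeviation.abs_empProb_sub_le {ρ : Measure (Example d)} {z : ℕ → Example d}
    {t : ℕ} {ε : ℝ} (ht : 1 ≤ t)
    (h : SmallDeviation ρ z t (t * ε)) : |empProb z t - posProb ρ| ≤ ε := by
  have ht0 : (0 : ℝ) < t := by exact_mod_cast ht
  have h1 := h.1
  rw [Finset.sum_sub_distrib, Finset.sum_const, Finset.card_range, nsmul_eq_mul] at h1
  have e : empProb z t - posProb ρ
      = (∑ i ∈ Finset.range t, posIndicator (z i) - t * posProb ρ) / t := by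
    rw [empProb, labelCount, sub_div, mul_div_cancel_left₀ _ ht0.ne']
    rfl
  rw [e, abs_div, abs_of_pos ht0, div_le_iff₀ ht0, mul_comm ε]
  exact h1

variable {ρ : Measure (Example d)} [IsProbabilityMeasure ρ] {κ : ℝ}

theorem abs_centredScore_le (hκ0 : 0 ≤ κ) (hκ : ∀ᵐ z ∂ρ, ‖z.1‖ ≤ κ) (y : ℤˣ) (j : Fin d) :
    ∀ᵐ e ∂ρ, |centredScore ρ y j e| ≤ 2 * κ := by
  refine hκ.mono fun e he => ?_
  rw [centredScore]
  split_ifs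
  · exact (PiLp.norm_apply_le (e.1 - condMean ρ y) j).trans
      (norm_sub_le_two_mul he (norm_condMean_le hκ0 hκ y))
  · rw [abs_zero]; positivity

theorem integral_centredScore (hκ : ∀ᵐ z ∂ρ, ‖z.1‖ ≤ κ) {y : ℤˣ}
    (hy : 0 < ρ.real {z : Example d | z.2 = y}) (j : Fin d) :
    ∫ e, centredScore ρ y j e ∂ρ = 0 := by
  have e1 : (fun e => centredScore ρ y j e) = {z : Example d | z.2 = y}.indicator
      fun e => inner ℝ (EuclideanSpace.single j (1 : ℝ)) (e.1 - condMean ρ y) := by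
    ext e
    simp [centredScore, indicator_apply, EuclideanSpace.inner_single_left]
  have i1 := (integrable_fst hκ).integrableOn (s := {z : Example d | z.2 = y})
  have i2 : Integrable (fun _ : Example d => condMean ρ y) (ρ.restrict {z | z.2 = y}) :=
    integrable_const _
  have i3 : Integrable (fun e : Example d => e.1 - condMean ρ y) (ρ.restrict {z | z.2 = y}) :=
    i1.sub i2
  rw [e1, integral_indicator (measurableSet_label y), integral_inner i3,
    integral_sub i1 i2, setIntegral_fst hy, setIntegral_const, sub_self, inner_zero_right]

/-- The true label probability m replaces the empirical frequency q as divisor, so no lower bound on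
the number of examples with label y, and no minimal t, is required. -/
theorem SmallDeviation.norm_labelMean_sub_le {z : ℕ → Example d} {t : ℕ} {ε : ℝ} (ht : 1 ≤ t)
    (h : SmallDeviation ρ z t (t * ε)) (hκ0 : 0 ≤ κ) (hκ : ∀ᵐ z ∂ρ, ‖z.1‖ ≤ κ)
    (hz : ∀ i, ‖(z i).1‖ ≤ κ) {y : ℤˣ} (hy : 0 < ρ.real {z : Example d | z.2 = y}) :
    ‖labelMean z y t - condMean ρ y‖ ≤ (2 * κ + d) / ρ.real {z : Example d | z.2 = y} * ε := by
  have ht0 : (0 : ℝ) < t := by exact_mod_cast ht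
  have hp := h.abs_empProb_sub_le ht
  set m := ρ.real {z : Example d | z.2 = y} with hm
  set q := labelCount z y t / t with hq
  set x := labelMean z y t - condMean ρ y with hx
  have hx2 : ‖x‖ ≤ 2 * κ :=
    norm_sub_le_two_mul (norm_labelMean_le hκ0 hz y t) (norm_condMean_le hκ0 hκ y)
  have hmq : |m - q| ≤ ε := by
    rcases Int.units_eq_one_or y with rfl | rfl
    · rw [abs_sub_comm]; exact hp
    · rw [hm, measureReal_label_neg_one, hq, show labelCount z (-1) t = t - labelCount z 1 t by
        linarith [labelCount_add z t], sub_div, div_self ht0.ne', sub_sub_sub_cancel_left]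
      exact hp
  have hqx : ‖q • x‖ ≤ d * ε := by
    rw [hq, div_eq_inv_mul, mul_smul, hx, labelCount_smul_labelMean_sub, norm_smul, norm_inv,
      Real.norm_of_nonneg ht0.le, inv_mul_le_iff₀ ht0]
    have := norm_le_card_mul (x := ∑ i ∈ Finset.range t,
      if (z i).2 = y then (z i).1 - condMean ρ y else 0) (Δ := t * ε) fun j => by
        refine le_trans (le_of_eq ?_) (h.2 y j)
        rw [WithLp.ofLp_sum, Finset.sum_apply]
        congr 1
        refine Finset.sum_congr rfl fun i _ => ?_
        rw [centredScore]
        split_ifs <;> rfl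
    linarith
  have hmx : m * ‖x‖ ≤ (2 * κ + d) * ε := by
    -- The first term is small because q is close to m and ‖x‖ ≤ 2κ; the second is a normalized sum
    -- of centred scores.
    have e : m • x = (m - q) • x + q • x := by module
    have h1 : m * ‖x‖ = ‖m • x‖ := by rw [norm_smul, Real.norm_of_nonneg hy.le]
    rw [h1, e]
    refine (norm_add_le _ _).trans ?_
    rw [norm_smul, Real.norm_eq_abs]
    have := mul_le_mul hmq hx2 (norm_nonneg _) ((abs_nonneg _).trans hmq)
    linarith
  rw [div_mul_eq_mul_div, le_div_iff₀ hy, mul_comm]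
  exact hmx

/-- The factor by which deviations of the scores affect the stochastic gradients. -/
noncomputable def deviationFactor (ρ : Measure (Example d)) (κ : ℝ) : ℝ :=
  1 + (2 * κ + d) / ρ.real {z : Example d | z.2 = 1}
    + (2 * κ + d) / ρ.real {z : Example d | z.2 = -1}

theorem SmallDeviation.norm_stochGrad_sub_le {z : ℕ → Example d} {t : ℕ} {ε : ℝ} (ht : 1 ≤ t)
    (h : SmallDeviation ρ z t (t * ε)) (hκ1 : 1 ≤ κ) (hκ : ∀ᵐ z ∂ρ, ‖z.1‖ ≤ κ)
    (hz : ∀ i, ‖(z i).1‖ ≤ κ) (hp0 : 0 < posProb ρ) (hp1 : posProb ρ < 1) (w : Vec d) :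
    ‖stochGrad z t w - idealGrad ρ (z t) w‖
      ≤ 28 * κ ^ 2 * (1 + ‖w‖) * (deviationFactor ρ κ * ε) := by
  have h0 := zero_le_one.trans hκ1
  refine (norm_surrogateGrad_sub_le (empProb_nonneg z t) (empProb_le_one z t) hp0.le hp1.le
    (norm_labelMean_le h0 hz _ _) (norm_labelMean_le h0 hz _ _) (norm_condMean_le h0 hκ _)
    (norm_condMean_le h0 hκ _) (hz t) hκ1 w).trans ?_
  have h1 := h.abs_empProb_sub_le ht
  have h2 := h.norm_labelMean_sub_le ht h0 hκ hz (y := 1) hp0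
  have h3 := h.norm_labelMean_sub_le ht h0 hκ hz (y := -1)
    (by rw [measureReal_label_neg_one]; linarith)
  refine mul_le_mul_of_nonneg_left ?_ (by positivity)
  rw [deviationFactor, add_mul, add_mul]
  linarith

end Empirical

/-! ### Growth of the regularizer and size of the iterates. -/

section Boundedness

variable {d : ℕ} {reg : Vec d → ℝ} {reg' : Vec d → Vec d} {A₁ A₂ : ℝ}

/-- The subgradient inequality at 0 gives Ω(w) ≤ ‖Ω'(w)‖‖w‖. Young's inequality and self-bounding
then bound 2bΩ(w) by bΩ(w) + A₂ + b²‖w‖² with b = max{1, A₁}, and one bΩ(w) cancels. -/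
theorem SelfBounding.reg_le (hself : SelfBounding reg reg' A₁ A₂) (hreg0 : ∀ v, 0 ≤ reg v)
    (hz : reg 0 = 0) (hreg' : ∀ w, IsSubgradientAt reg (reg' w) w) (w : Vec d) :
    reg w ≤ A₂ + max 1 A₁ * ‖w‖ ^ 2 := by
  obtain ⟨h1, h2, h3⟩ := hself
  have h4 := hreg' w 0
  have h5 := h3 w
  have h6 := hreg0 w
  rw [hz, zero_sub, inner_neg_right] at h4
  have h7 := real_inner_le_norm (reg' w) w
  set b := max 1 A₁ with hb
  have hb1 : 1 ≤ b := le_max_left _ _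
  have hbA : A₁ ≤ b := le_max_right _ _
  have h8 : ‖reg' w‖ ^ 2 ≤ b * reg w + A₂ := h5.trans (by gcongr)
  have h9 : 2 * b * (‖reg' w‖ * ‖w‖) ≤ ‖reg' w‖ ^ 2 + b ^ 2 * ‖w‖ ^ 2 := by
    nlinarith [sq_nonneg (‖reg' w‖ - b * ‖w‖)]
  have h10 : 2 * b * reg w ≤ 2 * b * (‖reg' w‖ * ‖w‖) :=
    mul_le_mul_of_nonneg_left (by linarith) (by linarith)
  have h11 : b * reg w ≤ b * (A₂ + b * ‖w‖ ^ 2) := by nlinarith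
  exact le_of_mul_le_mul_left h11 (by linarith)

theorem SelfBounding.norm_sq_le (hself : SelfBounding reg reg' A₁ A₂) (hreg0 : ∀ v, 0 ≤ reg v)
    (hz : reg 0 = 0) (hreg' : ∀ w, IsSubgradientAt reg (reg' w) w) (w : Vec d) :
    ‖reg' w‖ ^ 2 ≤ (A₁ * A₂ + A₂ + A₁ * max 1 A₁) * (1 + ‖w‖ ^ 2) := by
  have h1 := hself.reg_le hreg0 hz hreg' w
  obtain ⟨hA1, hA2, h3⟩ := hself
  have h4 := mul_le_mul_of_nonneg_left h1 hA1
  have h5 : 0 ≤ A₁ * max 1 A₁ := mul_nonneg hA1 (zero_le_one.trans (le_max_left _ _))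
  have h6 : 0 ≤ (A₁ * A₂ + A₂) * ‖w‖ ^ 2 := by positivity
  nlinarith [h3 w]

theorem norm_add_sq_le_two_mul {E : Type*} [SeminormedAddCommGroup E] (x y : E) :
    ‖x + y‖ ^ 2 ≤ 2 * ‖x‖ ^ 2 + 2 * ‖y‖ ^ 2 := by
  have := pow_le_pow_left₀ (norm_nonneg _) (norm_add_le x y) 2
  nlinarith [sq_nonneg (‖x‖ - ‖y‖)]

/-- The iterates of SPAUC are bounded by the accumulated step sizes. -/
theorem IsSPAUC.norm_sq_le {η : ℕ → ℝ} {z : ℕ → Example d} {w : ℕ → Vec d} {κ : ℝ}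
    (h : IsSPAUC reg η z w) (hreg : ConvexOn ℝ univ reg) (hreg0 : ∀ v, 0 ≤ reg v)
    (hzero : reg 0 = 0) (hreg' : ∀ w, IsSubgradientAt reg (reg' w) w)
    (hself : SelfBounding reg reg' A₁ A₂) (hη : ∀ t, 0 ≤ η t) (hη1 : ∀ t, η t ≤ 1)
    (hηA : ∀ t, A₁ * η t ≤ 1) (hηκ : ∀ t, 16 * κ ^ 2 * η t ≤ 1) (hκ : 0 ≤ κ)
    (hz : ∀ i, ‖(z i).1‖ ≤ κ) (t : ℕ) :
    ‖w (t + 1)‖ ^ 2 ≤ (1 / 2 + 2 * A₂) * ∑ k ∈ Finset.Icc 1 t, η k := by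
  induction t with
  | zero => simp [h.1]
  | succ t ih =>
    -- The comparison point is 0, where Ω vanishes and the surrogate equals p_t(1 - p_t) ≤ 1/4. The
    -- gains -2ηF and -2ηΩ then cover the squared gradients.
    have hstep := (h.isProx hreg hη (Nat.le_add_left 1 t)).norm_sub_sq_le (hη _) (hreg' _) 0
    rw [Finset.sum_Icc_succ_top (by omega), mul_add]
    rw [sub_zero, sub_zero, hzero] at hstep
    have hp0 := empProb_nonneg z (t + 1)
    have hp1 := empProb_le_one z (t + 1)
    have hF0 := surrogate_nonneg hp0 hp1 (labelMean z 1 (t + 1)) (labelMean z (-1) (t + 1))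
      (z (t + 1)) (w (t + 1))
    have hc := surrogate_add_inner_le hp0 hp1 (labelMean z 1 (t + 1)) (labelMean z (-1) (t + 1))
      (z (t + 1)) (w (t + 1)) 0
    rw [surrogate_zero] at hc
    have hg := norm_surrogateGrad_sq_le hp0 hp1 (norm_labelMean_le hκ hz 1 (t + 1))
      (norm_labelMean_le hκ hz (-1) (t + 1)) (hz (t + 1)) (w (t + 1))
    change surrogate _ _ _ _ _ + inner ℝ (stochGrad z (t + 1) (w (t + 1))) _ ≤ _ at hc
    change ‖stochGrad z (t + 1) (w (t + 1))‖ ^ 2 ≤ _ at hg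
    set F := surrogate (empProb z (t + 1)) (labelMean z 1 (t + 1)) (labelMean z (-1) (t + 1))
      (z (t + 1)) (w (t + 1))
    set g := stochGrad z (t + 1) (w (t + 1))
    set g' := reg' (w (t + 1))
    set e := η (t + 1)
    have he0 : 0 ≤ e := hη _
    have he1 : e ≤ 1 := hη1 _
    have hΩ := hreg0 (w (t + 1))
    have hg' : ‖g'‖ ^ 2 ≤ A₁ * reg (w (t + 1)) + A₂ := hself.2.2 _
    have hA2 := hself.2.1
    have hpp : empProb z (t + 1) * (1 - empProb z (t + 1)) ≤ 1 / 4 := by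
      nlinarith [sq_nonneg (empProb z (t + 1) - 1 / 2)]
    have h1 : e ^ 2 * ‖g‖ ^ 2 ≤ e * F := by
      have : e * (16 * κ ^ 2 * e) * F ≤ e * 1 * F := by gcongr; exact hηκ _
      nlinarith [mul_le_mul_of_nonneg_left hg (sq_nonneg e)]
    have h2 : e ^ 2 * ‖g'‖ ^ 2 ≤ e * reg (w (t + 1)) + e * A₂ := by
      have h3 : e * (A₁ * e) * reg (w (t + 1)) ≤ e * 1 * reg (w (t + 1)) := by
        gcongr; exact hηA _
      have h4 : e * e * A₂ ≤ e * 1 * A₂ := by gcongr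
      nlinarith [mul_le_mul_of_nonneg_left hg' (sq_nonneg e)]
    have h5 := mul_le_mul_of_nonneg_left (norm_add_sq_le_two_mul g g') (sq_nonneg e)
    have h6 : 2 * e * inner ℝ g (0 - w (t + 1)) ≤ 2 * e * (1 / 4 - F) :=
      mul_le_mul_of_nonneg_left (by linarith) (by linarith)
    linarith

end Boundedness

/-! ### One-step inequality for the distance to the minimizers. -/

section OneStep

variable {d : ℕ} {ρ : Measure (Example d)} [IsProbabilityMeasure ρ] {reg : Vec d → ℝ}
  {reg' : Vec d → Vec d} {A₁ A₂ κ : ℝ}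

/-- The noise at step `k`: the deviation of the stochastic from the expected gradient, tested
against the direction to the nearest minimizer. -/
noncomputable def noise (ρ : Measure (Example d)) (reg : Vec d → ℝ) (e : Example d) (w : Vec d) : ℝ :=
  inner ℝ (star (objective ρ reg) w - w) (idealGrad ρ e w)
    - inner ℝ (star (objective ρ reg) w - w) (riskGrad ρ w)

theorem one_add_norm_sq_le {E : Type*} [SeminormedAddCommGroup E] {w : E} {N : ℝ}
    (h : 1 + ‖w‖ ^ 2 ≤ N) : (1 + ‖w‖) ^ 2 ≤ 2 * N := by
  nlinarith [sq_nonneg (1 - ‖w‖)]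

theorem IsSPAUC.norm_sub_star_sq_step {η : ℕ → ℝ} {z : ℕ → Example d} {w : ℕ → Vec d}
    (h : IsSPAUC reg η z w) (hreg : ConvexOn ℝ univ reg) (hreg0 : ∀ v, 0 ≤ reg v)
    (hzero : reg 0 = 0) (hreg' : ∀ w, IsSubgradientAt reg (reg' w) w)
    (hself : SelfBounding reg reg' A₁ A₂) (hη : ∀ t, 0 ≤ η t) (hκ1 : 1 ≤ κ)
    (hκ : ∀ᵐ z ∂ρ, ‖z.1‖ ≤ κ) (hz : ∀ i, ‖(z i).1‖ ≤ κ) (hp0 : 0 < posProb ρ)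
    (hp1 : posProb ρ < 1) (hmin : (minimizers (objective ρ reg)).Nonempty)
    {k : ℕ} (hk : 1 ≤ k) {N x M : ℝ} (hN : 1 + ‖w k‖ ^ 2 ≤ N) (hx : 0 ≤ x)
    (hdev : SmallDeviation ρ z k (2 * κ * √(2 * k * x)))
    (hM : 12544 * κ ^ 6 * deviationFactor ρ κ ^ 2 * N * x
      + (256 * κ ^ 4 + 2 * (A₁ * A₂ + A₂ + A₁ * max 1 A₁)) * N ≤ M) :
    ‖w (k + 1) - star (objective ρ reg) (w (k + 1))‖ ^ 2
      ≤ ‖w k - star (objective ρ reg) (w k)‖ ^ 2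
        + 2 * η k * (-(objective ρ reg (w k) - ⨅ v, objective ρ reg v) + noise ρ reg (z k) (w k)
          + √(‖w k - star (objective ρ reg) (w k)‖ ^ 2 * (M / k))) + η k ^ 2 * M := by
  have hconv := convexOn_of_subgradient (objective_subgradient hκ1 hκ hp0 hp1 hreg')
  have hκ0 : 0 ≤ κ := zero_le_one.trans hκ1
  have hk0 : (0 : ℝ) < k := by exact_mod_cast hk
  have hA1 := hself.1
  have hA2 := hself.2.1
  have hN0 : 0 ≤ N := le_trans (by positivity) hN
  have hmax : 0 ≤ max 1 A₁ := zero_le_one.trans (le_max_left _ _)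
  rw [iInf_eq_apply_star hconv hmin (w k)]
  set v := star (objective ρ reg) (w k) with hv
  -- The new distance is measured to the old projection, which can only increase it.
  have h1 := norm_sub_star_le hconv hmin (w (k + 1)) (star_mem hconv hmin (w k))
  have h2 := pow_le_pow_left₀ (norm_nonneg _) h1 2
  have h3 := (h.isProx hreg hη hk).norm_sub_sq_le (hη k) (hreg' (w k)) v
  set g := stochGrad z k (w k) with hg
  set g₀ := idealGrad ρ (z k) (w k) with hg₀
  have h4 := risk_add_inner_le hκ1 hκ hp0 hp1 (w k) v
  -- the estimation error
  set ε : ℝ := 2 * κ * √(2 * k * x) / k with hε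
  have hε0 : 0 ≤ ε := by positivity
  have hεk : (k : ℝ) * ε = 2 * κ * √(2 * k * x) := by rw [hε]; field_simp
  have hε2 : ε ^ 2 = 8 * κ ^ 2 * x / k := by
    rw [hε, div_pow, mul_pow, Real.sq_sqrt (by positivity)]
    field_simp
    ring
  have hw := one_add_norm_sq_le hN
  have h5 := SmallDeviation.norm_stochGrad_sub_le (ε := ε) hk (by rw [hεk]; exact hdev) hκ1 hκ hz
    hp0 hp1 (w k)
  have h6 : ‖g - g₀‖ ^ 2 ≤ M / k := by
    calc ‖g - g₀‖ ^ 2 ≤ (28 * κ ^ 2 * (1 + ‖w k‖) * (deviationFactor ρ κ * ε)) ^ 2 :=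
          pow_le_pow_left₀ (norm_nonneg _) h5 2
      _ = 784 * κ ^ 4 * (1 + ‖w k‖) ^ 2 * deviationFactor ρ κ ^ 2 * ε ^ 2 := by ring
      _ ≤ 784 * κ ^ 4 * (2 * N) * deviationFactor ρ κ ^ 2 * ε ^ 2 := by gcongr
      _ = 12544 * κ ^ 6 * deviationFactor ρ κ ^ 2 * N * x / k := by rw [hε2]; ring
      _ ≤ M / k := by
          gcongr
          refine le_trans ?_ hM
          have : 0 ≤ (256 * κ ^ 4 + 2 * (A₁ * A₂ + A₂ + A₁ * max 1 A₁)) * N := by positivity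
          linarith
  have h7 : inner ℝ (g - g₀) (v - w k) ≤ √(‖w k - v‖ ^ 2 * (M / k)) := by
    refine Real.le_sqrt_of_sq_le ?_
    rw [← sq_abs]
    calc _ ≤ (‖g - g₀‖ * ‖v - w k‖) ^ 2 :=
          pow_le_pow_left₀ (abs_nonneg _) (abs_real_inner_le_norm _ _) 2
      _ = ‖w k - v‖ ^ 2 * ‖g - g₀‖ ^ 2 := by rw [norm_sub_rev v (w k)]; ring
      _ ≤ _ := by gcongr
  -- the size of the stochastic gradient
  have h8 : ‖g + reg' (w k)‖ ^ 2 ≤ M := by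
    have hgn : ‖g‖ ≤ 8 * κ ^ 2 * (1 + ‖w k‖) :=
      norm_surrogateGrad_le (empProb_nonneg z k) (empProb_le_one z k)
        (norm_labelMean_le hκ0 hz _ _) (norm_labelMean_le hκ0 hz _ _) (hz k) hκ1 (w k)
    have e1 : ‖g‖ ^ 2 ≤ 128 * κ ^ 4 * N := by
      calc ‖g‖ ^ 2 ≤ (8 * κ ^ 2 * (1 + ‖w k‖)) ^ 2 := pow_le_pow_left₀ (norm_nonneg _) hgn 2
        _ = 64 * κ ^ 4 * (1 + ‖w k‖) ^ 2 := by ring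
        _ ≤ 64 * κ ^ 4 * (2 * N) := by gcongr
        _ = _ := by ring
    have e2 : ‖reg' (w k)‖ ^ 2 ≤ (A₁ * A₂ + A₂ + A₁ * max 1 A₁) * N :=
      (hself.norm_sq_le hreg0 hzero hreg' (w k)).trans (by gcongr)
    have e3 : 0 ≤ 12544 * κ ^ 6 * deviationFactor ρ κ ^ 2 * N * x := by positivity
    have e4 := norm_add_sq_le_two_mul g (reg' (w k))
    linarith
  have h9 : inner ℝ g (v - w k) + (reg v - reg (w k))
      ≤ -(objective ρ reg (w k) - objective ρ reg v) + noise ρ reg (z k) (w k)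
        + √(‖w k - v‖ ^ 2 * (M / k)) := by
    have e : inner ℝ g (v - w k)
        = inner ℝ (riskGrad ρ (w k)) (v - w k) + noise ρ reg (z k) (w k)
          + inner ℝ (g - g₀) (v - w k) := by
      rw [noise, ← hv, ← hg₀, inner_sub_left g g₀, real_inner_comm g₀ (v - w k),
        real_inner_comm (riskGrad ρ (w k)) (v - w k)]
      ring
    rw [e, objective, objective]
    linarith
  have h10 := mul_le_mul_of_nonneg_left h9 (show 0 ≤ 2 * η k by linarith [hη k])
  have h11 := mul_le_mul_of_nonneg_left h8 (sq_nonneg (η k))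
  linarith

end OneStep

/-! ### Arithmetic from the summed recursion to the rates. -/

section Rates

/-- From the recursion bound to the rate of the iterates. -/
theorem rate_of_sq_mul_le {t t₁ Λ K c₀ a D : ℝ} (ht : 1 ≤ t) (hc₀ : 0 < c₀) (ht₁ : c₀ ≤ t₁)
    (hΛ : 1 ≤ Λ) (hK : 0 ≤ K) (ha : 0 ≤ a) (hD : 0 ≤ D)
    (h : (t + t₁ + a) * (t + t₁ + a - 1) * D ≤ K * (t₁ ^ 2 + Λ * (t + t₁))) :
    D ≤ 2 * (1 + 1 / c₀) ^ 2 * K * t₁ * Λ / (t + 1) := by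
  have ht1 : 0 < t₁ := by linarith
  set u := t + t₁ with hu
  have hu0 : 0 < u := by linarith
  -- Since u = t + t₁ ≥ 1 + c₀, the factor u - 1 is comparable with u.
  have h1 : u - 1 ≥ 1 / (1 + 1 / c₀) * u := by
    rw [ge_iff_le, one_div_mul_eq_div, div_le_iff₀ (by positivity)]
    have : c₀ * (1 / c₀) = 1 := by field_simp
    have h2 : c₀ * (1 / c₀) ≤ (u - 1) * (1 / c₀) := by gcongr; linarith
    linarith
  set b := 1 + 1 / c₀ with hb
  have hb0 : 0 < b := by positivity
  have h2 : u * (1 / b * u) * D ≤ K * (t₁ ^ 2 + Λ * u) := by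
    refine le_trans ?_ h
    have : 0 ≤ 1 / b * u := by positivity
    gcongr ?_ * ?_ * D <;> linarith
  have h3 : t₁ ^ 2 + Λ * u ≤ b * (t₁ * Λ) * u := by
    have e1 : t₁ ^ 2 ≤ t₁ * Λ * u := by
      have : t₁ ≤ Λ * u := by nlinarith
      nlinarith
    have e2 : Λ * u ≤ 1 / c₀ * (t₁ * Λ) * u := by
      have : 1 ≤ 1 / c₀ * t₁ := by rw [one_div_mul_eq_div, le_div_iff₀ hc₀]; linarith
      have h4 : 0 ≤ Λ * u := by positivity
      nlinarith
    rw [hb]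
    linarith
  have h4 : D * u ≤ b ^ 2 * K * t₁ * Λ := by
    have h5 : u * (D * u) ≤ u * (b ^ 2 * K * t₁ * Λ) := by
      calc u * (D * u) = b * (u * (1 / b * u) * D) := by field_simp
        _ ≤ b * (K * (t₁ ^ 2 + Λ * u)) := by gcongr
        _ ≤ b * (K * (b * (t₁ * Λ) * u)) := by gcongr
        _ = _ := by ring
    exact le_of_mul_le_mul_left h5 hu0
  rw [le_div_iff₀ (by linarith)]
  have h5 : D * (t + 1) ≤ D * (2 * u) := by gcongr; linarith
  linarith

/-- From the recursion bound to the rate of the averages. -/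
theorem rate_of_sum_mul_le {t₁ Λ K c₀ a σ Φ : ℝ} {h : ℕ → ℝ} {t : ℕ} (ht : 1 ≤ t) (hc₀ : 0 < c₀)
    (ht₁ : c₀ ≤ t₁) (hΛ : 1 ≤ Λ) (hK : 0 ≤ K) (hσ : 0 < σ) (ha : 0 ≤ a) (hh : ∀ k, 0 ≤ h k)
    (hsum : 1 / (2 * σ) * ∑ k ∈ Finset.Icc 1 t, (k + t₁ + a - 1) * h k
      ≤ K * (t₁ ^ 2 + Λ * (t + t₁)))
    (hΦ : (∑ k ∈ Finset.Icc 1 t, ((k : ℝ) + t₁ + 1)) * Φ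
      ≤ ∑ k ∈ Finset.Icc 1 t, ((k : ℝ) + t₁ + 1) * h k) :
    Φ ≤ 4 * σ * (1 + 2 / c₀) * (1 / c₀ + 1 / c₀ ^ 2) * K * t₁ ^ 2 * Λ / t := by
  have ht0 : (1 : ℝ) ≤ t := by exact_mod_cast ht
  have ht1 : 0 < t₁ := by linarith
  have hden : (t : ℝ) * (t + t₁) / 2 ≤ ∑ k ∈ Finset.Icc 1 t, ((k : ℝ) + t₁ + 1) := by
    clear hΦ hsum ht ht0
    induction t with
    | zero => simp
    | succ t ih =>
      rw [Finset.sum_Icc_succ_top (by omega)]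
      push_cast
      nlinarith [(Nat.cast_nonneg t : (0 : ℝ) ≤ t)]
  -- The averaging weights exceed those of the recursion by 2 - a ≤ 2, while the latter are at least
  -- t₁ ≥ c₀.
  have hnum : ∑ k ∈ Finset.Icc 1 t, ((k : ℝ) + t₁ + 1) * h k
      ≤ (1 + 2 / c₀) * ∑ k ∈ Finset.Icc 1 t, (k + t₁ + a - 1) * h k := by
    rw [Finset.mul_sum]
    refine Finset.sum_le_sum fun k hk => ?_
    have hk1 : (1 : ℝ) ≤ k := by exact_mod_cast (Finset.mem_Icc.1 hk).1
    rw [← mul_assoc]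
    refine mul_le_mul_of_nonneg_right ?_ (hh k)
    have e : 2 ≤ 2 / c₀ * (k + t₁ + a - 1) := by
      rw [div_mul_eq_mul_div, le_div_iff₀ hc₀]
      nlinarith
    linarith
  have hS : ∑ k ∈ Finset.Icc 1 t, (k + t₁ + a - 1) * h k
      ≤ 2 * σ * (K * (t₁ ^ 2 + Λ * (t + t₁))) := by
    rw [div_mul_eq_mul_div, div_le_iff₀ (by positivity)] at hsum
    linarith
  have hR : 0 ≤ 4 * σ * (1 + 2 / c₀) * (1 / c₀ + 1 / c₀ ^ 2) * K * t₁ ^ 2 * Λ / t := by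
    have : 0 ≤ Λ := by linarith
    positivity
  -- Assuming the contrary makes Φ positive enough to multiply the lower bound on the total weight
  -- by it.
  by_contra! hlt
  have hΦ0 : 0 ≤ Φ := hR.trans hlt.le
  have h1 : (t : ℝ) * (t + t₁) / 2 * Φ
      ≤ (1 + 2 / c₀) * (2 * σ * (K * (t₁ ^ 2 + Λ * (t + t₁)))) := by
    calc _ ≤ (∑ k ∈ Finset.Icc 1 t, ((k : ℝ) + t₁ + 1)) * Φ := by gcongr
      _ ≤ _ := hΦ
      _ ≤ _ := hnum
      _ ≤ _ := by gcongr
  have h2 : t₁ ^ 2 + Λ * (t + t₁) ≤ (1 / c₀ + 1 / c₀ ^ 2) * t₁ ^ 2 * Λ * (t + t₁) := by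
    have hr : 1 ≤ t₁ / c₀ := by rw [le_div_iff₀ hc₀]; linarith
    have e1 : t₁ ^ 2 ≤ 1 / c₀ * t₁ ^ 2 * Λ * (t + t₁) := by
      have : t₁ ≤ (t₁ / c₀) * Λ * (t + t₁) := by
        have : 1 ≤ t₁ / c₀ * Λ := by nlinarith
        nlinarith
      calc t₁ ^ 2 = t₁ * t₁ := by ring
        _ ≤ t₁ * ((t₁ / c₀) * Λ * (t + t₁)) := by gcongr
        _ = _ := by ring
    have e2 : Λ * (t + t₁) ≤ 1 / c₀ ^ 2 * t₁ ^ 2 * Λ * (t + t₁) := by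
      have : 1 ≤ (t₁ / c₀) ^ 2 := one_le_pow₀ hr
      calc Λ * (t + t₁) = 1 * (Λ * (t + t₁)) := by ring
        _ ≤ (t₁ / c₀) ^ 2 * (Λ * (t + t₁)) := by gcongr
        _ = _ := by ring
    linarith
  have h3 : (t + t₁) * (t * Φ) ≤ (t + t₁) * (4 * σ * (1 + 2 / c₀) * (1 / c₀ + 1 / c₀ ^ 2) * K
      * t₁ ^ 2 * Λ) := by
    have h4 : (1 + 2 / c₀) * (2 * σ * (K * (t₁ ^ 2 + Λ * (t + t₁))))
        ≤ (1 + 2 / c₀) * (2 * σ * (K * ((1 / c₀ + 1 / c₀ ^ 2) * t₁ ^ 2 * Λ * (t + t₁)))) := by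
      gcongr
    linarith
  have h4 := le_of_mul_le_mul_left h3 (by linarith)
  rw [div_lt_iff₀ (by linarith)] at hlt
  linarith

end Rates

/-! ### Deterministic convergence on the good event. -/

section GoodEvent

variable {d : ℕ}

theorem one_le_kappa (X : Set (Vec d)) : 1 ≤ kappa X := le_max_left _ _

theorem norm_le_kappa {X : Set (Vec d)} (hX : Bornology.IsBounded X) {x : Vec d} (hx : x ∈ X) :
    ‖x‖ ≤ kappa X := by
  obtain ⟨C, hC⟩ := hX.exists_norm_le
  exact (le_csSup ⟨C, by rintro _ ⟨v, hv, rfl⟩; exact hC v hv⟩ (mem_image_of_mem _ hx)).trans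
    (le_max_right _ _)

theorem sixteen_le_constC1 (X : Set (Vec d)) (A₁ : ℝ) : 16 ≤ constC1 X A₁ :=
  le_trans (by nlinarith [one_le_kappa X]) (le_max_right _ _)

theorem stepSize_eq {σφ σΩ : ℝ} (hσφ : 0 < σφ) (t₁ : ℝ) (k : ℕ) :
    stepSize σφ σΩ t₁ k = 2 / (σφ * (k + t₁ + 2 * (σφ - σΩ) / σφ)) := by
  rw [stepSize]
  congr 1
  field_simp
  ring

/-- The iterates satisfy `1 + ‖w_t‖² ≤ iterateBound σ A₂ * L`. -/
noncomputable def iterateBound (σ A₂ : ℝ) : ℝ := 1 + (1 / 2 + 2 * A₂) * (4 / σ)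

/-- The variance proxy of the noise is `noiseBound X σ A₂ * L` times the squared distance to the
minimizers. -/
noncomputable def noiseBound (X : Set (Vec d)) (σ A₂ : ℝ) : ℝ :=
  128 * kappa X ^ 4 * iterateBound σ A₂

/-- The weights of the noise in the exponential martingale used at time `t`. -/
noncomputable def noiseWeight (X : Set (Vec d)) (σφ σΩ A₂ L t₁ : ℝ) (t k : ℕ) : ℝ :=
  σφ / (4 * (noiseBound X σφ A₂ * L) * (t + t₁ + 2 * (σφ - σΩ) / σφ))
    * (k + t₁ + 2 * (σφ - σΩ) / σφ - 1)

/-- The range of the noise at `w`. -/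
noncomputable def noiseRange (X : Set (Vec d)) (φ : Vec d → ℝ) (w : Vec d) : ℝ :=
  8 * kappa X ^ 2 * (1 + ‖w‖) * ‖star φ w - w‖

variable {X : Set (Vec d)} {ρ : Measure (Example d)} [IsProbabilityMeasure ρ] {reg : Vec d → ℝ}
  {reg' : Vec d → Vec d} {A₁ A₂ σφ σΩ : ℝ}

theorem IsSPAUC.one_add_norm_sq_le (hreg : ConvexOn ℝ univ reg) (hreg0 : ∀ v, 0 ≤ reg v)
    (hzero : reg 0 = 0) (hreg' : ∀ w, IsSubgradientAt reg (reg' w) w)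
    (hself : SelfBounding reg reg' A₁ A₂) (hσφ : 0 < σφ) (hσ : 0 ≤ σφ - σΩ) {T : ℕ} {L t₁ : ℝ}
    (hL : 1 ≤ L) (hT : Real.log T ≤ L) (ht₁ : 32 * constC1 X A₁ * σφ⁻¹ ≤ t₁)
    {z : ℕ → Example d} {w : ℕ → Vec d} (h : IsSPAUC reg (stepSize σφ σΩ t₁) z w)
    (hz : ∀ i, ‖(z i).1‖ ≤ kappa X) {k : ℕ} (hk : 1 ≤ k) (hkT : k ≤ T) :
    1 + ‖w k‖ ^ 2 ≤ iterateBound σφ A₂ * L := by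
  have hC1 := sixteen_le_constC1 X A₁
  have hκ1 := one_le_kappa X
  have hA2 := hself.2.1
  have ht1 : 32 * constC1 X A₁ ≤ σφ * t₁ := by
    rw [← div_eq_mul_inv, div_le_iff₀ hσφ] at ht₁
    linarith
  have hη0 : ∀ t, 0 ≤ stepSize σφ σΩ t₁ t := fun t =>
    div_nonneg zero_le_two (by have : 0 ≤ σφ * t := by positivity
                               linarith)
  have hηC : ∀ t, constC1 X A₁ * stepSize σφ σΩ t₁ t ≤ 1 := fun t => by
    have : 0 ≤ σφ * t := by positivity
    rw [stepSize, mul_div_assoc', div_le_one (by linarith)]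
    linarith
  have hηk : ∀ t : ℕ, 1 ≤ t → stepSize σφ σΩ t₁ t ≤ 2 / σφ * (t : ℝ)⁻¹ := fun t ht => by
    have ht0 : (0 : ℝ) < t := by exact_mod_cast ht
    rw [stepSize, ← div_eq_mul_inv, div_div]
    refine div_le_div_of_nonneg_left zero_le_two (by positivity) ?_
    linarith
  obtain ⟨j, rfl⟩ := Nat.exists_eq_add_of_le' hk
  have hb := h.norm_sq_le (κ := kappa X) hreg hreg0 hzero hreg' hself hη0
    (fun t => by nlinarith [hηC t, hη0 t])
    (fun t => (mul_le_mul_of_nonneg_right (le_max_left _ _) (hη0 t)).trans (hηC t))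
    (fun t => (mul_le_mul_of_nonneg_right (le_max_right _ _) (hη0 t)).trans (hηC t))
    (by linarith) hz j
  have hlog : Real.log j ≤ L := by
    rcases Nat.eq_zero_or_pos j with rfl | hj
    · simp; linarith
    · exact (Real.log_le_log (by exact_mod_cast hj) (by exact_mod_cast (by omega))).trans hT
  have hsum : ∑ i ∈ Finset.Icc 1 j, stepSize σφ σΩ t₁ i ≤ 2 / σφ * (2 * L) := by
    calc _ ≤ ∑ i ∈ Finset.Icc 1 j, 2 / σφ * (i : ℝ)⁻¹ :=
          Finset.sum_le_sum fun i hi => hηk i (Finset.mem_Icc.1 hi).1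
      _ = 2 / σφ * ∑ i ∈ Finset.Icc 1 j, (i : ℝ)⁻¹ := by rw [Finset.mul_sum]
      _ ≤ 2 / σφ * (2 * L) := by
          have := sum_Icc_inv_le j
          gcongr
          linarith
  have h2 := mul_le_mul_of_nonneg_left hsum (show 0 ≤ 1 / 2 + 2 * A₂ by positivity)
  have e : iterateBound σφ A₂ * L = L + (1 / 2 + 2 * A₂) * (2 / σφ * (2 * L)) := by
    rw [iterateBound]; ring
  linarith

theorem noiseRange_sq_le {φ : Vec d → ℝ} {w : Vec d} {L : ℝ}
    (h : 1 + ‖w‖ ^ 2 ≤ iterateBound σφ A₂ * L) :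
    noiseRange X φ w ^ 2 ≤ noiseBound X σφ A₂ * L * ‖w - star φ w‖ ^ 2 := by
  have h1 := SPAUC.one_add_norm_sq_le h
  calc noiseRange X φ w ^ 2 = 64 * kappa X ^ 4 * (1 + ‖w‖) ^ 2 * ‖w - star φ w‖ ^ 2 := by
        rw [noiseRange, norm_sub_rev]; ring
    _ ≤ 64 * kappa X ^ 4 * (2 * (iterateBound σφ A₂ * L)) * ‖w - star φ w‖ ^ 2 := by gcongr
    _ = _ := by rw [noiseBound]; ring

/-- With x = cL, R = c_R L and M = c_M L², the noise contributes L², and the harmonic sum multiplies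
M by a further L. This is the origin of the power L³. -/
theorem recursion_bound_le {σ c₀ t₁ a D₁ c cR cM L : ℝ} {t : ℕ} (hσ : 0 < σ) (hc₀ : 0 < c₀)
    (ht₁ : c₀ ≤ t₁) (ha2 : a ≤ 2) (hD₁ : 0 ≤ D₁) (hc : 0 ≤ c) (hcR : 0 ≤ cR)
    (hcM : 0 ≤ cM) (hL : 1 ≤ L) (ht : 1 ≤ t) (hlog : Real.log t ≤ L) :
    (t₁ + 2) ^ 2 * D₁ + 16 * (c * L) * (cR * L) * (t + t₁ + a) / σ ^ 2
      + 8 * (cM * L ^ 2) / σ ^ 2 * ∑ k ∈ Finset.Icc 1 t, (1 + (t₁ + 2) * ((k : ℝ))⁻¹)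
      ≤ ((1 + 2 / c₀) ^ 2 * D₁ + 16 * c * cR * (1 + 2 / c₀) / σ ^ 2
        + 16 * cM * (1 + 2 / c₀) / σ ^ 2) * (t₁ ^ 2 + L ^ 3 * (t + t₁)) := by
  have ht0 : (1 : ℝ) ≤ t := by exact_mod_cast ht
  have ht1 : 0 < t₁ := hc₀.trans_le ht₁
  set b := 1 + 2 / c₀ with hb
  have hb1 : 1 ≤ b := by rw [hb]; linarith [show 0 ≤ 2 / c₀ by positivity]
  have hbt : t₁ + 2 ≤ b * t₁ := by
    have : 2 ≤ 2 / c₀ * t₁ := by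
      rw [div_mul_eq_mul_div, le_div_iff₀ hc₀]
      linarith
    rw [hb]; linarith
  have hbs : t + t₁ + a ≤ b * (t + t₁) := by nlinarith
  have q1 : (t₁ + 2) ^ 2 * D₁ ≤ b ^ 2 * D₁ * t₁ ^ 2 := by
    calc _ ≤ (b * t₁) ^ 2 * D₁ := by gcongr
      _ = _ := by ring
  have q2 : 16 * (c * L) * (cR * L) * (t + t₁ + a) / σ ^ 2
      ≤ 16 * c * cR * b / σ ^ 2 * (L ^ 3 * (t + t₁)) := by
    have h23 : L ^ 2 ≤ L ^ 3 := pow_le_pow_right₀ hL (by norm_num)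
    calc _ ≤ 16 * (c * L) * (cR * L) * (b * (t + t₁)) / σ ^ 2 := by gcongr
      _ = 16 * c * cR * b / σ ^ 2 * (L ^ 2 * (t + t₁)) := by ring
      _ ≤ _ := by gcongr
  have q3 : 8 * (cM * L ^ 2) / σ ^ 2 * ∑ k ∈ Finset.Icc 1 t, (1 + (t₁ + 2) * ((k : ℝ))⁻¹)
      ≤ 16 * cM * b / σ ^ 2 * (L ^ 3 * (t + t₁)) := by
    have hs : ∑ k ∈ Finset.Icc 1 t, (1 + (t₁ + 2) * ((k : ℝ))⁻¹) ≤ 2 * b * L * (t + t₁) := by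
      rw [Finset.sum_add_distrib, ← Finset.mul_sum]
      have e1 : ∑ k ∈ Finset.Icc 1 t, (1 : ℝ) = t := by simp
      have e2 := sum_Icc_inv_le t
      have e3 : (t₁ + 2) * ∑ k ∈ Finset.Icc 1 t, ((k : ℝ))⁻¹ ≤ b * t₁ * (2 * L) := by
        gcongr
        linarith
      have e4 : (t : ℝ) ≤ 2 * b * L * t := by
        have : 1 ≤ b * L := by nlinarith
        nlinarith
      rw [e1]
      linarith
    calc _ ≤ 8 * (cM * L ^ 2) / σ ^ 2 * (2 * b * L * (t + t₁)) := by gcongr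
      _ = _ := by ring
  have q4 : 0 ≤ b ^ 2 * D₁ * (L ^ 3 * (t + t₁)) := by positivity
  have q5 : 0 ≤ 16 * c * cR * b / σ ^ 2 * t₁ ^ 2 := by positivity
  have q6 : 0 ≤ 16 * cM * b / σ ^ 2 * t₁ ^ 2 := by positivity
  linarith

set_option maxHeartbeats 1000000 in
/-- On the event that the empirical means are accurate and that the martingale is small, SPAUC
converges at the asserted rates. -/
theorem exists_rate_of_small_deviation (hX : Bornology.IsBounded X) (hρX : ∀ᵐ z ∂ρ, z.1 ∈ X)
    (hp0 : 0 < posProb ρ) (hp1 : posProb ρ < 1) (hreg : ConvexOn ℝ univ reg)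
    (hreg0 : ∀ v, 0 ≤ reg v) (hzero : reg 0 = 0)
    (hreg' : ∀ w, IsSubgradientAt reg (reg' w) w) (hself : SelfBounding reg reg' A₁ A₂)
    (hmin : (minimizers (objective ρ reg)).Nonempty)
    (hgrowth : QuadraticGrowth (objective ρ reg) σφ) (hσΩ : 0 ≤ σΩ) (hσ : 0 ≤ σφ - σΩ) {c : ℝ}
    (hc : 0 ≤ c) :
    ∃ C : ℝ, ∀ (T : ℕ) (L t₁ : ℝ), 1 ≤ L → Real.log T ≤ L → 32 * constC1 X A₁ * σφ⁻¹ ≤ t₁ →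
      ∀ (z : ℕ → Example d) (w : ℕ → Vec d), IsSPAUC reg (stepSize σφ σΩ t₁) z w →
      (∀ i, ‖(z i).1‖ ≤ kappa X) →
      (∀ t, 1 ≤ t → t ≤ T → SmallDeviation ρ z t (2 * kappa X * √(2 * t * (c * L)))) →
      (∀ t, 1 ≤ t → t ≤ T → ∑ k ∈ Finset.Icc 1 t,
        (noiseWeight X σφ σΩ A₂ L t₁ t k * noise ρ reg (z k) (w k)
          - noiseWeight X σφ σΩ A₂ L t₁ t k ^ 2 * noiseRange X (objective ρ reg) (w k) ^ 2 / 2)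
        ≤ c * L) →
      ∀ t : ℕ, 1 ≤ t → t ≤ T →
        ‖w t - star (objective ρ reg) (w t)‖ ^ 2 ≤ C * t₁ * L ^ 3 / t ∧
        objective ρ reg (weightedAverage t₁ w t) - ⨅ v, objective ρ reg v
          ≤ C * t₁ ^ 2 * L ^ 3 / t := by
  have hσφ := hgrowth.1
  have hA1 := hself.1
  have hA2 := hself.2.1
  have hκ1 := one_le_kappa X
  have hκ : ∀ᵐ z ∂ρ, ‖z.1‖ ≤ kappa X := hρX.mono fun z hz => norm_le_kappa hX hz
  have hsub := objective_subgradient hκ1 hκ hp0 hp1 hreg'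
  have hconv := convexOn_of_subgradient hsub
  have hC1 := sixteen_le_constC1 X A₁
  set κ := kappa X with hκdef
  set φ := objective ρ reg with hφ
  set a := 2 * (σφ - σΩ) / σφ with ha
  have ha0 : 0 ≤ a := by positivity
  have ha2 : a ≤ 2 := by rw [ha, div_le_iff₀ hσφ]; linarith
  set c₀ := 32 * constC1 X A₁ * σφ⁻¹ with hc₀def
  have hc₀ : 0 < c₀ := by positivity
  set cN := iterateBound σφ A₂ with hcN
  have hcN0 : 0 < cN := by rw [hcN, iterateBound]; positivity
  set cR := noiseBound X σφ A₂ with hcR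
  have hcR0 : 0 < cR := by rw [hcR, noiseBound]; positivity
  have hmax : 0 ≤ max 1 A₁ := zero_le_one.trans (le_max_left _ _)
  set cM := (12544 * κ ^ 6 * deviationFactor ρ κ ^ 2 * c
    + (256 * κ ^ 4 + 2 * (A₁ * A₂ + A₂ + A₁ * max 1 A₁))) * cN with hcM
  have hcM0 : 0 ≤ cM := by positivity
  set b := 1 + 2 / c₀ with hb
  have hb0 : 0 ≤ b := by positivity
  set D₁ := ‖(0 : Vec d) - star φ 0‖ ^ 2 with hD₁
  have hD₁0 : 0 ≤ D₁ := by positivity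
  set K := b ^ 2 * D₁ + 16 * c * cR * b / σφ ^ 2 + 16 * cM * b / σφ ^ 2 with hK
  have hK0 : 0 ≤ K := by positivity
  set Ca := 2 * (1 + 1 / c₀) ^ 2 * K with hCa
  set Cb := 4 * σφ * (1 + 2 / c₀) * (1 / c₀ + 1 / c₀ ^ 2) * K with hCb
  have hCa0 : 0 ≤ Ca := by positivity
  have hCb0 : 0 ≤ Cb := by positivity
  clear_value a cN cR cM b D₁ K Ca Cb
  -- `Ca` serves the iterates from t = 2 on, `Cb` the averages, and D₁/c₀ the first iterate, which
  -- the recursion does not reach.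
  refine ⟨Ca + Cb + D₁ / c₀, fun T L t₁ hL hT ht₁ z w hw hz hdev hmart => ?_⟩
  have ht1 : 0 < t₁ := hc₀.trans_le ht₁
  have hL3 : 1 ≤ L ^ 3 := one_le_pow₀ hL
  have hη0 : ∀ t, 0 ≤ stepSize σφ σΩ t₁ t := fun t => by
    rw [stepSize_eq hσφ]; positivity
  have hbound : ∀ k, 1 ≤ k → k ≤ T → 1 + ‖w k‖ ^ 2 ≤ cN * L := fun k hk hkT =>
    hcN ▸ hw.one_add_norm_sq_le hreg hreg0 hzero hreg' hself hσφ hσ hL hT ht₁ hz hk hkT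
  set D : ℕ → ℝ := fun k => ‖w k - star φ (w k)‖ ^ 2 with hD
  set h : ℕ → ℝ := fun k => φ (w k) - ⨅ v, φ v with hh
  have hD0 : ∀ k, 0 ≤ D k := fun k => by positivity
  have hDh : ∀ k, σφ * D k ≤ h k := fun k => by
    simp only [hD, hh]
    rw [iInf_eq_apply_star hconv hmin (w k)]
    exact hgrowth.2 (w k)
  have hh0 : ∀ k, 0 ≤ h k := fun k => (mul_nonneg hσφ.le (hD0 k)).trans (hDh k)
  have hstep : ∀ k : ℕ, 1 ≤ k → k ≤ T → D (k + 1) ≤ D k + 2 * (2 / (σφ * (k + t₁ + a)))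
      * (-h k + noise ρ reg (z k) (w k) + √(D k * (cM * L ^ 2 / k)))
      + (2 / (σφ * (k + t₁ + a))) ^ 2 * (cM * L ^ 2) := fun k hk hkT => by
    rw [ha, ← stepSize_eq hσφ]
    refine hw.norm_sub_star_sq_step hreg hreg0 hzero hreg' hself hη0 hκ1 hκ hz hp0 hp1 hmin hk
      (hbound k hk hkT) (x := c * L) (by positivity) (hdev k hk hkT) ?_
    have hLL : L ≤ L ^ 2 := by nlinarith
    have e : 0 ≤ (256 * κ ^ 4 + 2 * (A₁ * A₂ + A₂ + A₁ * max 1 A₁)) * cN := by positivity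
    calc _ = 12544 * κ ^ 6 * deviationFactor ρ κ ^ 2 * c * cN * L ^ 2
          + (256 * κ ^ 4 + 2 * (A₁ * A₂ + A₂ + A₁ * max 1 A₁)) * cN * L := by ring
      _ ≤ 12544 * κ ^ 6 * deviationFactor ρ κ ^ 2 * c * cN * L ^ 2
          + (256 * κ ^ 4 + 2 * (A₁ * A₂ + A₂ + A₁ * max 1 A₁)) * cN * L ^ 2 := by gcongr
      _ = _ := by rw [hcM]; ring
  have hmain : ∀ t : ℕ, 1 ≤ t → t ≤ T → (t + t₁ + a) * (t + t₁ + a - 1) * D (t + 1)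
      + 1 / (2 * σφ) * ∑ k ∈ Finset.Icc 1 t, (k + t₁ + a - 1) * h k
      ≤ K * (t₁ ^ 2 + L ^ 3 * (t + t₁)) := fun t ht htT => by
    have ht0 : (1 : ℝ) ≤ t := by exact_mod_cast ht
    have hm : ∑ k ∈ Finset.Icc 1 t, (σφ / (4 * (cR * L) * (t + t₁ + a)) * (k + t₁ + a - 1)
        * noise ρ reg (z k) (w k)
        - (σφ / (4 * (cR * L) * (t + t₁ + a)) * (k + t₁ + a - 1)) ^ 2 * (cR * L * D k) / 2)
        ≤ c * L := by
      refine le_trans (Finset.sum_le_sum fun k hk => ?_) (hmart t ht htT)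
      obtain ⟨hk1, hkt⟩ := Finset.mem_Icc.1 hk
      have hr := noiseRange_sq_le (X := X) (φ := φ) (hcN ▸ hbound k hk1 (hkt.trans htT))
      rw [noiseWeight, ← hcR, ← ha]
      rw [← hcR] at hr
      refine sub_le_sub_left ?_ _
      gcongr
    have hrec := recursion_bound hσφ ha0 ha2 ht1 (by positivity) (by positivity) hD0 hDh hstep
      ht htT hm
    have hw1 : D 1 = D₁ := by simp only [hD, hD₁, hw.1]
    rw [hw1] at hrec
    rw [hK, hb]
    exact hrec.trans (recursion_bound_le hσφ hc₀ ht₁ ha2 hD₁0 hc hcR0.le hcM0 hL ht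
      ((Real.log_le_log (by linarith) (by exact_mod_cast htT)).trans hT))
  intro t ht htT
  have ht0 : (1 : ℝ) ≤ t := by exact_mod_cast ht
  have hpart : ∀ s : ℕ, 1 ≤ s →
      0 ≤ (s + t₁ + a) * (s + t₁ + a - 1) * D (s + 1) ∧
      0 ≤ 1 / (2 * σφ) * ∑ k ∈ Finset.Icc 1 s, (k + t₁ + a - 1) * h k := fun s hs => by
    have hs0 : (1 : ℝ) ≤ s := by exact_mod_cast hs
    refine ⟨mul_nonneg (mul_nonneg (by linarith) (by linarith)) (hD0 _),
      mul_nonneg (by positivity) (Finset.sum_nonneg fun k hk => mul_nonneg ?_ (hh0 k))⟩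
    have : (1 : ℝ) ≤ k := by exact_mod_cast (Finset.mem_Icc.1 hk).1
    linarith
  constructor
  · rcases Nat.lt_or_ge t 2 with h2 | h2
    · obtain rfl : t = 1 := by omega
      have hw1 : ‖w 1 - star φ (w 1)‖ ^ 2 = D₁ := by rw [hD₁, hw.1]
      rw [hw1, Nat.cast_one, div_one]
      have e1 : D₁ ≤ D₁ / c₀ * t₁ := by
        rw [div_mul_eq_mul_div, le_div_iff₀ hc₀]
        gcongr
      have e2 : D₁ / c₀ * t₁ ≤ (Ca + Cb + D₁ / c₀) * t₁ := by
        gcongr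
        linarith
      have e3 : 0 ≤ (Ca + Cb + D₁ / c₀) * t₁ := by positivity
      nlinarith
    -- The recursion summed up to s controls the iterate of index s + 1.
    · obtain ⟨s, rfl⟩ := Nat.exists_eq_add_of_le' ht
      have hs : 1 ≤ s := by omega
      have h1 := hmain s hs (by omega)
      have h3 := rate_of_sq_mul_le (t := s) (by exact_mod_cast hs) hc₀ ht₁ hL3 hK0 ha0
        (hD0 (s + 1)) (by linarith [(hpart s hs).2])
      push_cast
      rw [← hCa] at h3
      refine h3.trans ?_
      gcongr
      linarith [show 0 ≤ D₁ / c₀ by positivity]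
  · have h1 := hmain t ht htT
    have hden : 0 < ∑ k ∈ Finset.Icc 1 t, ((k : ℝ) + t₁ + 1) :=
      Finset.sum_pos (fun k _ => by positivity) ⟨1, Finset.mem_Icc.2 ⟨le_rfl, ht⟩⟩
    have hjen := jensen_of_subgradient (Finset.Icc 1 t) (fun k : ℕ => (k : ℝ) + t₁ + 1) w
      (fun k _ => by positivity) hden hsub
    have h3 := rate_of_sum_mul_le (Φ := φ (weightedAverage t₁ w t) - ⨅ v, φ v) ht hc₀ ht₁ hL3 hK0
      hσφ ha0 hh0 (by linarith [(hpart t ht).1]) (by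
        simp only [hh, mul_sub, Finset.sum_sub_distrib, ← Finset.sum_mul]
        exact sub_le_sub_right hjen _)
    rw [← hCb] at h3
    refine h3.trans ?_
    gcongr
    linarith [show 0 ≤ D₁ / c₀ by positivity]

end GoodEvent

/-! ### Probability of the bad events. -/

section Probability

variable {d : ℕ} {X : Set (Vec d)} {ρ : Measure (Example d)} [IsProbabilityMeasure ρ]
  {S : Type*} [MeasurableSpace S] {P : Measure S} [IsProbabilityMeasure P]
  {z : ℕ → S → Example d}

/-- A union over the label indicator and the 2d coordinate scores, two-sided, gives 2(1 + 2d) tails.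
-/
theorem measure_deviation_le (hz : ∀ i, Measurable (z i)) (hlaw : ∀ i, P.map (z i) = ρ)
    (hind : iIndepFun z P) {κ : ℝ} (hκ1 : 1 ≤ κ) (hκ : ∀ᵐ z ∂ρ, ‖z.1‖ ≤ κ)
    (hp0 : 0 < posProb ρ) (hp1 : posProb ρ < 1) {t : ℕ} (ht : 1 ≤ t) {x : ℝ} (hx : 0 ≤ x) :
    P.real {s | ¬SmallDeviation ρ (fun i => z i s) t (2 * κ * √(2 * t * x))}
      ≤ (2 + 4 * d) * Real.exp (-x) := by
  have hκ0 : 0 < 2 * κ := by linarith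
  set Δ := 2 * κ * √(2 * t * x) with hΔ
  set A : Set S := {s | Δ ≤ |∑ i ∈ Finset.range t, (posIndicator (z i s) - ∫ e, posIndicator e ∂ρ)|}
  set B : ℤˣ × Fin d → Set S := fun q => {s | Δ ≤ |∑ i ∈ Finset.range t,
    (centredScore ρ q.1 q.2 (z i s) - ∫ e, centredScore ρ q.1 q.2 e ∂ρ)|}
  have hA : P.real A ≤ 2 * Real.exp (-x) :=
    measure_abs_sum_sub_ge_le hz hlaw hind measurable_posIndicator hκ0
      (Filter.Eventually.of_forall fun e => (abs_posIndicator_le e).trans (by linarith)) ht hx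
  have hB : ∀ q, P.real (B q) ≤ 2 * Real.exp (-x) := fun q =>
    measure_abs_sum_sub_ge_le hz hlaw hind (measurable_centredScore ρ q.1 q.2) hκ0
      (abs_centredScore_le (by linarith) hκ q.1 q.2) ht hx
  have hint : ∀ (y : ℤˣ) (j : Fin d), ∫ e, centredScore ρ y j e ∂ρ = 0 := fun y j => by
    refine integral_centredScore hκ ?_ j
    rcases Int.units_eq_one_or y with rfl | rfl
    · exact hp0
    · rw [measureReal_label_neg_one]; linarith
  have hsub : {s | ¬SmallDeviation ρ (fun i => z i s) t Δ} ⊆ A ∪ ⋃ q ∈ Finset.univ, B q := by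
    intro s hs
    by_contra hcon
    simp only [mem_union, mem_iUnion, not_or, not_exists] at hcon
    refine hs ⟨?_, fun y j => ?_⟩
    · have := hcon.1
      simp only [A, mem_ofPred_eq, not_le, integral_posIndicator] at this
      exact this.le
    · have := hcon.2 (y, j) (Finset.mem_univ _)
      simp only [B, mem_ofPred_eq, not_le, hint, sub_zero] at this
      exact this.le
  calc _ ≤ P.real (A ∪ ⋃ q ∈ Finset.univ, B q) := measureReal_mono hsub
    _ ≤ P.real A + P.real (⋃ q ∈ Finset.univ, B q) := measureReal_union_le _ _
    _ ≤ 2 * Real.exp (-x) + ∑ q : ℤˣ × Fin d, 2 * Real.exp (-x) := by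
        gcongr
        exact (measureReal_biUnion_finset_le _ _).trans (Finset.sum_le_sum fun q _ => hB q)
    _ = _ := by
        simp only [Finset.sum_const, Finset.card_univ, Fintype.card_prod, Fintype.card_units_int,
          Fintype.card_fin, nsmul_eq_mul]
        push_cast
        ring

theorem measure_noise_sum_gt_le (hz : ∀ i, Measurable (z i)) (hlaw : ∀ i, P.map (z i) = ρ)
    (hind : iIndepFun z P) (hX : Bornology.IsBounded X) (hρX : ∀ᵐ z ∂ρ, z.1 ∈ X)
    (hp0 : 0 < posProb ρ) (hp1 : posProb ρ < 1) {reg : Vec d → ℝ} {reg' : Vec d → Vec d}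
    (hreg : ConvexOn ℝ univ reg) (hreg0 : ∀ v, 0 ≤ reg v)
    (hreg' : ∀ w, IsSubgradientAt reg (reg' w) w)
    (hmin : (minimizers (objective ρ reg)).Nonempty) {η : ℕ → ℝ} (hη : ∀ t, 0 ≤ η t)
    (b : ℕ → ℝ) (t : ℕ) (x : ℝ) :
    P.real {s | ¬∑ k ∈ Finset.Icc 1 t,
      (b k * noise ρ reg (z k s) (iterates reg η k fun i => z i s)
        - b k ^ 2 * noiseRange X (objective ρ reg) (iterates reg η k fun i => z i s) ^ 2 / 2) ≤ x}
      ≤ Real.exp (-x) := by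
  have hκ1 := one_le_kappa X
  have hκ : ∀ᵐ z ∂ρ, ‖z.1‖ ≤ kappa X := hρX.mono fun z hz => norm_le_kappa hX hz
  have hconv := convexOn_of_subgradient (objective_subgradient hκ1 hκ hp0 hp1 hreg')
  have hstar := (continuous_star hconv hmin).measurable
  set φ := objective ρ reg
  have hW := measurable_iterates hreg hreg0 hη
  have hdir : ∀ k, Measurable fun h : ℕ → Example d =>
      star φ (iterates reg η k h) - iterates reg η k h := fun k =>
    (hstar.comp (hW k)).sub (hW k)
  have key := measure_martingale_sum_ge_le hz hlaw hind
    (fun k h e => inner ℝ (star φ (iterates reg η k h) - iterates reg η k h)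
      (idealGrad ρ e (iterates reg η k h)))
    (fun k h => noiseRange X φ (iterates reg η k h))
    (fun k => ((hdir k).comp measurable_fst).inner (Measurable.surrogateGrad measurable_const
      measurable_const measurable_const measurable_snd ((hW k).comp measurable_fst)))
    (fun k => ((measurable_const.add (hW k).norm).const_mul _).mul (hdir k).norm)
    (fun k h h' hh => by simp only [iterates_congr reg η k hh])
    (fun k h h' hh => by simp only [iterates_congr reg η k hh])
    (fun k h => (norm_idealGrad_le hκ1 hκ (iterates reg η k h)).mono fun e he => by
      refine (abs_real_inner_le_norm _ _).trans ?_
      rw [noiseRange, mul_comm]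
      gcongr)
    -- The martingale runs over all examples from index 0, whereas the algorithm starts at step 1; a
    -- zero coefficient removes the extra term.
    (fun k => if k = 0 then 0 else b k) (t + 1) x
  refine le_trans (measureReal_mono fun s hs => ?_) key
  simp only [mem_ofPred_eq, not_le] at hs ⊢
  refine hs.le.trans (le_of_eq ?_)
  have hss : Finset.Icc 1 t ⊆ Finset.range (t + 1) := fun k hk =>
    Finset.mem_range.2 (by have := (Finset.mem_Icc.1 hk).2; omega)
  rw [← Finset.sum_subset hss]
  · refine Finset.sum_congr rfl fun k hk => ?_
    have hk0 : k ≠ 0 := by have := (Finset.mem_Icc.1 hk).1; omega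
    rw [if_neg hk0, integral_inner (integrable_idealGrad hκ1 hκ _)]
    rfl
  · intro k hk hk'
    have : k = 0 := by
      simp only [Finset.mem_range, Finset.mem_Icc] at hk hk'
      omega
    simp [this]

end Probability

end SPAUC

/-! ### The union bound and the conclusion. -/

theorem mainTheorem5 {d : ℕ}
    -- the data distribution: a law on `X × {1, -1}` with `X` bounded and both labels possible
    (X : Set (SPAUC.Vec d)) (hX : Bornology.IsBounded X)
    (ρ : Measure (SPAUC.Example d)) [IsProbabilityMeasure ρ]
    (hρX : ∀ᵐ z ∂ρ, z.1 ∈ X)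
    (hp0 : 0 < SPAUC.posProb ρ) (hp1 : SPAUC.posProb ρ < 1)
    -- the convex regularizer, with a choice of subgradients
    (reg : SPAUC.Vec d → ℝ) (hconv : ConvexOn ℝ univ reg)
    (hreg_nonneg : ∀ w, 0 ≤ reg w) (hreg_zero : reg 0 = 0)
    (reg' : SPAUC.Vec d → SPAUC.Vec d) (hreg' : ∀ w, SPAUC.IsSubgradientAt reg (reg' w) w)
    (A₁ A₂ : ℝ) (hself : SPAUC.SelfBounding reg reg' A₁ A₂)
    -- existence of minimizers and quadratic functional growth
    (hmin : (SPAUC.minimizers (SPAUC.objective ρ reg)).Nonempty)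
    (σφ : ℝ) (hgrowth : SPAUC.QuadraticGrowth (SPAUC.objective ρ reg) σφ)
    -- the (possibly zero) modulus of strong convexity of the regularizer
    (σΩ : ℝ) (hσΩ : 0 ≤ σΩ)
    (hstrong : ∀ w v, σΩ / 2 * ‖w - v‖ ^ 2 ≤ reg w - reg v - inner ℝ (w - v) (reg' v))
    (hσ : 0 ≤ σφ - σΩ) :
    ∃ (C : ℝ) (q : ℕ), ∀ (T : ℕ) (δ t₁ : ℝ), 2 < T → 0 < δ → δ < 1 →
      32 * SPAUC.constC1 X A₁ * σφ⁻¹ * Real.log (2 * T / δ) ≤ t₁ →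
      ∀ (S : Type*) [MeasurableSpace S] (P : Measure S) [IsProbabilityMeasure P]
        (z : ℕ → S → SPAUC.Example d) (w : ℕ → S → SPAUC.Vec d),
        (∀ i, Measurable (z i)) → (∀ i, P.map (z i) = ρ) → iIndepFun z P →
        (∀ s, SPAUC.IsSPAUC reg (SPAUC.stepSize σφ σΩ t₁) (fun i => z i s) (fun t => w t s)) →
        1 - δ ≤ P.real {s | ∀ t : ℕ, 1 ≤ t → t ≤ T →
          ‖w t s - SPAUC.star (SPAUC.objective ρ reg) (w t s)‖ ^ 2
              ≤ C * t₁ * Real.log (T / δ) ^ q / t ∧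
          SPAUC.objective ρ reg (SPAUC.weightedAverage t₁ (fun k => w k s) t)
              - ⨅ v, SPAUC.objective ρ reg v
            ≤ C * t₁ ^ 2 * Real.log (T / δ) ^ q / t} := by
  have hσφ := hgrowth.1
  have hd : (1 : ℝ) ≤ 3 + 4 * d := by linarith [(Nat.cast_nonneg d : (0 : ℝ) ≤ d)]
  have hlogd : 0 ≤ Real.log (3 + 4 * d) := Real.log_nonneg hd
  obtain ⟨C, hC⟩ := SPAUC.exists_rate_of_small_deviation hX hρX hp0 hp1 hconv hreg_nonneg hreg_zero
    hreg' hself hmin hgrowth hσΩ hσ (c := 1 + Real.log (3 + 4 * d)) (by linarith)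
  refine ⟨C, 3, fun T δ t₁ hT hδ0 hδ1 ht₁ S _ P _ z w hz hlaw hind hw => ?_⟩
  have hT3 : (3 : ℝ) ≤ T := by exact_mod_cast hT
  have hT0 : (0 : ℝ) < T := by linarith
  have hTδ : (T : ℝ) ≤ T / δ := by rw [le_div_iff₀ hδ0]; nlinarith
  set L := Real.log (T / δ) with hLdef
  -- T > 2 means T ≥ 3 > e, so L absorbs additive constants.
  have hL1 : 1 ≤ L := by
    rw [hLdef, Real.le_log_iff_exp_le (by positivity)]
    linarith [Real.exp_one_lt_three]
  have hTL : Real.log T ≤ L := Real.log_le_log hT0 hTδ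
  have hC1 := SPAUC.sixteen_le_constC1 X A₁
  have ht₁' : 32 * SPAUC.constC1 X A₁ * σφ⁻¹ ≤ t₁ := by
    refine le_trans (le_mul_of_one_le_right (by positivity) ?_) ht₁
    refine hL1.trans (Real.log_le_log (by positivity) ?_)
    gcongr
    linarith
  have ht0 : 0 < t₁ := lt_of_lt_of_le (by positivity) ht₁'
  have hη : ∀ t, 0 ≤ SPAUC.stepSize σφ σΩ t₁ t := fun t => by
    rw [SPAUC.stepSize_eq hσφ]; positivity
  have hκ1 := SPAUC.one_le_kappa X
  have hκ : ∀ᵐ z ∂ρ, ‖z.1‖ ≤ SPAUC.kappa X := hρX.mono fun z hz => SPAUC.norm_le_kappa hX hz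
  -- As L ≥ 1, x ≥ L + log(3 + 4d), so exp(-x) ≤ δ / (T(3 + 4d)). This offsets the 2 + 4d deviation
  -- tails and the single martingale tail at each of the T times.
  set x := (1 + Real.log (3 + 4 * d)) * L with hx
  have hx0 : 0 ≤ x := by positivity
  set φ := SPAUC.objective ρ reg
  set N : Set S := {s | ¬∀ i, ‖(z i s).1‖ ≤ SPAUC.kappa X}
  set A : ℕ → Set S := fun t =>
    {s | ¬SPAUC.SmallDeviation ρ (fun i => z i s) t (2 * SPAUC.kappa X * √(2 * t * x))}
  set W : ℕ → S → SPAUC.Vec d := fun k s =>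
    SPAUC.iterates reg (SPAUC.stepSize σφ σΩ t₁) k fun i => z i s
  set B : ℕ → Set S := fun t => {s | ¬∑ k ∈ Finset.Icc 1 t,
    (SPAUC.noiseWeight X σφ σΩ A₂ L t₁ t k * SPAUC.noise ρ reg (z k s) (W k s)
      - SPAUC.noiseWeight X σφ σΩ A₂ L t₁ t k ^ 2 * SPAUC.noiseRange X φ (W k s) ^ 2 / 2) ≤ x}
  set G : Set S := {s | ∀ t : ℕ, 1 ≤ t → t ≤ T →
    ‖w t s - SPAUC.star φ (w t s)‖ ^ 2 ≤ C * t₁ * L ^ 3 / t ∧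
    φ (SPAUC.weightedAverage t₁ (fun k => w k s) t) - ⨅ v, φ v ≤ C * t₁ ^ 2 * L ^ 3 / t}
  have hN : P.real N = 0 := by
    have : ∀ᵐ s ∂P, ∀ i, ‖(z i s).1‖ ≤ SPAUC.kappa X := ae_all_iff.2 fun i => by
      rw [← hlaw i] at hκ
      exact ae_of_ae_map (hz i).aemeasurable hκ
    rw [measureReal_def, ae_iff.1 this, ENNReal.toReal_zero]
  have hA : ∀ t, 1 ≤ t → P.real (A t) ≤ (2 + 4 * d) * Real.exp (-x) := fun t ht =>
    SPAUC.measure_deviation_le hz hlaw hind hκ1 hκ hp0 hp1 ht hx0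
  have hB : ∀ t, P.real (B t) ≤ Real.exp (-x) := fun t =>
    SPAUC.measure_noise_sum_gt_le hz hlaw hind hX hρX hp0 hp1 hconv hreg_nonneg hreg' hmin hη _ t x
  -- The good event need not be measurable, because the iterates w are arbitrary functions on S.
  -- Covering the whole space and using subadditivity bounds its outer measure from below.
  have hcover : (univ : Set S) ⊆ G ∪ (N ∪ ⋃ t ∈ Finset.Icc 1 T, (A t ∪ B t)) := by
    intro s _
    by_contra hcon
    simp only [mem_union, mem_iUnion, not_or, not_exists, Finset.mem_Icc] at hcon
    obtain ⟨hG, hsN, hsAB⟩ := hcon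
    refine hG (hC T L t₁ hL1 hTL ht₁' (fun i => z i s) (fun t => w t s) (hw s) (not_not.1 hsN)
      (fun t ht htT => not_not.1 (hsAB t ⟨ht, htT⟩).1) fun t ht htT => ?_)
    refine le_trans (le_of_eq (Finset.sum_congr rfl fun k hk => ?_))
      (not_not.1 (hsAB t ⟨ht, htT⟩).2)
    have e : w k s = W k s := (hw s).eq_iterates hconv hreg_nonneg hη (Finset.mem_Icc.1 hk).1
    rw [e]
  have hexp : T * ((3 + 4 * d) * Real.exp (-x)) ≤ δ := by
    have h1 : L + Real.log (3 + 4 * d) ≤ x := by rw [hx]; nlinarith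
    have h2 : Real.exp (-x) ≤ δ / T / (3 + 4 * d) := by
      calc Real.exp (-x) ≤ Real.exp (-(L + Real.log (3 + 4 * d))) :=
            Real.exp_le_exp.2 (neg_le_neg h1)
        _ = δ / T / (3 + 4 * d) := by
            rw [Real.exp_neg, Real.exp_add, hLdef, Real.exp_log (by positivity),
              Real.exp_log (by positivity)]
            field_simp
    calc _ ≤ T * ((3 + 4 * d) * (δ / T / (3 + 4 * d))) := by gcongr
      _ = δ := by field_simp
  have hU : P.real (⋃ t ∈ Finset.Icc 1 T, (A t ∪ B t)) ≤ δ := by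
    refine (measureReal_biUnion_finset_le _ _).trans (le_trans ?_ hexp)
    calc _ ≤ ∑ t ∈ Finset.Icc 1 T, (3 + 4 * d) * Real.exp (-x) := by
          refine Finset.sum_le_sum fun t ht => (measureReal_union_le _ _).trans ?_
          linarith [hA t (Finset.mem_Icc.1 ht).1, hB t]
      _ = _ := by simp
  have h1 : (1 : ℝ) ≤ P.real G + (P.real N + P.real (⋃ t ∈ Finset.Icc 1 T, (A t ∪ B t))) := by
    calc (1 : ℝ) = P.real univ := probReal_univ.symm
      _ ≤ _ := measureReal_mono hcover
      _ ≤ _ := measureReal_union_le _ _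
      _ ≤ _ := by gcongr; exact measureReal_union_le _ _
  linarith
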